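/- A supernatural number is a formal product $q=\prod_p p^{k_p}$ over the primes with $k_p\in\{0,1,2,\dots,\infty\}$. If $q$ has infinitely many prime factors counted with multiplicity (infinitely many $k_p$ are nonzero, or some $k_p=\infty$), the $q$-odometer is the p.m.p. action of $\mathbb Z$ by translation by the image of $1$ on the inverse limit of the groups $\mathbb Z/(n_1\cdots n_j)\mathbb Z$ with its normalized Haar measure, where $(n_j)$ is any sequence of positive integers such that each prime $p$ occurs exactly $k_p$ times among the prime factorizations of the $n_j$. The universal odometer is the case $k_p=\infty$ for every $p$. Let $G\curvearrowright(X,\mu)$ and $H\curvearrowright(Y,\nu)$ be free p.m.p. actions of countable groups. They are Shannon orbit equivalent if there is a measure isomorphism $\varphi:X_0\to Y_0$ from a $G$-invariant conull set $X_0\subseteq X$ to an $H$-invariant conull set $Y_0\subseteq Y$ such that $\varphi(Gx)=H\varphi(x)$ for all $x\in X_0$ and such that, for the cocycles $\kappa:G\times X\to H$ and $\lambda:H\times Y\to G$ defined a.e. by $\kappa(g,x)\varphi(x)=\varphi(gx)$ and $\lambda(s,y)\varphi^{-1}(y)=\varphi^{-1}(sy)$, each of the countable partitions $\{\{x:\kappa(g,x)=s\}:s\in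 H\}$ for $g\in G$ and $\{\{y:\lambda(s,y)=g\}:g\in G\}$ for $s\in H$ has finite Shannon entropy. Here the Shannon entropy of a countable partition $\mathscr P$ of a probability space $(X,\mu)$ is $\sum_{A\in\mathscr P}-\mu(A)\log\mu(A)$. **Theorem.** For every supernatural number $q$ with infinitely many prime factors counted with multiplicity, the $q$-odometer is Shannon orbit equivalent to the universal odometer. -/

import Mathlib

open MeasureTheory
open scoped ENNReal

universe u v

noncomputable section

/-! ### Shannon orbit equivalence

Groups are written additively, since the acting groups of interest are copies of `ℤ`. -/

section OrbitEquivalence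

variable (G H : Type*) [AddGroup G] [AddGroup H]
variable {X : Type u} {Y : Type v} [MeasurableSpace X] [MeasurableSpace Y]
variable [AddAction G X] [AddAction H Y]

/-- The action of `G` on `(X, μ)` is probability-measure-preserving and (essentially) free. -/
structure IsFreePMPAction (μ : Measure X) : Prop where
  isProbabilityMeasure : IsProbabilityMeasure μ
  measurePreserving : ∀ g : G, MeasurePreserving (fun x : X => g +ᵥ x) μ μ
  free : ∀ᵐ x ∂μ, ∀ g : G, g +ᵥ x = x → g = 0

/-- An orbit equivalence: a measure isomorphism `φ` from a `G`-invariant conull set `X₀ ⊆ X`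
(`source`) to an `H`-invariant conull set `Y₀ ⊆ Y` (`target`) such that `φ (G x) = H (φ x)` for
all `x ∈ X₀`. -/
structure OrbitEquivalence (μ : Measure X) (ν : Measure Y) where
  source : Set X
  target : Set Y
  measurableSet_source : MeasurableSet source
  measurableSet_target : MeasurableSet target
  source_conull : μ sourceᶜ = 0
  target_conull : ν targetᶜ = 0
  source_invariant : ∀ (g : G) (x : X), x ∈ source → g +ᵥ x ∈ source
  target_invariant : ∀ (s : H) (y : Y), y ∈ target → s +ᵥ y ∈ target
  toEquiv : source ≃ᵐ target
  measurePreserving : MeasurePreserving toEquiv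
    (μ.comap (Subtype.val : source → X)) (ν.comap (Subtype.val : target → Y))
  map_orbit : ∀ x : source,
    {y : Y | ∃ z : source, (z : X) ∈ AddAction.orbit G (x : X) ∧ (toEquiv z : Y) = y} =
      AddAction.orbit H (toEquiv x : Y)

namespace OrbitEquivalence

variable {G H} {μ : Measure X} {ν : Measure Y}

/-- The piece `X_{g,s} = {x : κ(g, x) = s}` of the cocycle partition, where the cocycle `κ` is
determined (almost everywhere, by freeness) by `κ(g, x) φ(x) = φ(g x)`. -/
def sourceCell (φ : OrbitEquivalence G H μ ν) (g : G) (s : H) : Set X :=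
  {x | ∃ hx : x ∈ φ.source,
    s +ᵥ (φ.toEquiv ⟨x, hx⟩ : Y) = φ.toEquiv ⟨g +ᵥ x, φ.source_invariant g x hx⟩}

/-- The piece `Y_{s,g} = {y : lam(s, y) = g}` of the cocycle partition, where the cocycle `lam` is
determined (almost everywhere, by freeness) by `lam(s, y) φ⁻¹(y) = φ⁻¹(s y)`. -/
def targetCell (φ : OrbitEquivalence G H μ ν) (s : H) (g : G) : Set Y :=
  {y | ∃ hy : y ∈ φ.target,
    g +ᵥ (φ.toEquiv.symm ⟨y, hy⟩ : X) = φ.toEquiv.symm ⟨s +ᵥ y, φ.target_invariant s y hy⟩}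

end OrbitEquivalence

/-- The Shannon entropy `∑ -μ(A) log μ(A) ∈ [0, ∞]` of a countable disjoint family of subsets of a
probability space. -/
def shannonEntropy (μ : Measure X) {ι : Type*} (P : ι → Set X) : ℝ≥0∞ :=
  ∑' i, ENNReal.ofReal (Real.negMulLog (μ.real (P i)))

/-- A Shannon orbit equivalence: all the cocycle partitions `{X_{g,s} : s ∈ H}`, `g ∈ G`, and
`{Y_{s,g} : g ∈ G}`, `s ∈ H`, have finite Shannon entropy. -/
def OrbitEquivalence.IsShannon {G H : Type*} [AddGroup G] [AddGroup H]
    [AddAction G X] [AddAction H Y] {μ : Measure X} {ν : Measure Y}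
    (φ : OrbitEquivalence G H μ ν) : Prop :=
  (∀ g : G, shannonEntropy μ (fun s : H => φ.sourceCell g s) < ∞) ∧
    (∀ s : H, shannonEntropy ν (fun g : G => φ.targetCell s g) < ∞)

/-- Shannon orbit equivalence, a relation between free p.m.p. actions of countable groups. -/
def ShannonOrbitEquivalent [Countable G] [Countable H] (μ : Measure X) (ν : Measure Y) : Prop :=
  IsFreePMPAction G μ ∧ IsFreePMPAction H ν ∧
    ∃ φ : OrbitEquivalence G H μ ν, φ.IsShannon

end OrbitEquivalence

/-! ### Supernatural numbers -/

/-- A supernatural number `∏_p p^{k_p}` with `k_p ∈ {0, 1, 2, …, ∞}`, given by its exponents. -/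
def SupernaturalNumber : Type := Nat.Primes → ℕ∞

namespace SupernaturalNumber

/-- Infinitely many prime factors counted with multiplicity. -/
def HasInfinitelyManyPrimeFactors (q : SupernaturalNumber) : Prop :=
  {p : Nat.Primes | q p ≠ 0}.Infinite ∨ ∃ p : Nat.Primes, q p = ⊤

/-- The prime `p` occurs exactly `k_p` times among the prime factorizations of the `n j`. -/
def IsProductOf (q : SupernaturalNumber) (n : ℕ → ℕ+) : Prop :=
  ∀ p : Nat.Primes,
    ⨆ J : ℕ, ((∑ j ∈ Finset.range J, (n j : ℕ).factorization (p : ℕ) : ℕ) : ℕ∞) = q p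

/-- The supernatural number all of whose exponents are `∞`. -/
def universal : SupernaturalNumber := fun _ => ⊤

end SupernaturalNumber

/-! ### Odometers -/

/-- The product `n 0 * ⋯ * n (j - 1)`. -/
def partialProduct (n : ℕ → ℕ+) (j : ℕ) : ℕ := ∏ i ∈ Finset.range j, (n i : ℕ)

instance partialProduct.instNeZero (n : ℕ → ℕ+) (j : ℕ) : NeZero (partialProduct n j) :=
  ⟨Finset.prod_ne_zero_iff.2 fun i _ => (n i).ne_zero⟩

theorem partialProduct_dvd_succ (n : ℕ → ℕ+) (j : ℕ) :
    partialProduct n j ∣ partialProduct n (j + 1) :=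
  ⟨(n j : ℕ), Finset.prod_range_succ _ _⟩

/-- Reduction `ℤ/(n 0 ⋯ n j)ℤ → ℤ/(n 0 ⋯ n (j - 1))ℤ`. -/
def reduction (n : ℕ → ℕ+) (j : ℕ) :
    ZMod (partialProduct n (j + 1)) →+* ZMod (partialProduct n j) :=
  ZMod.castHom (partialProduct_dvd_succ n j) _

/-- The inverse limit of the cyclic groups `ℤ/(n 0 ⋯ n (j - 1))ℤ`, as a subgroup of their
product. -/
def odometerSubgroup (n : ℕ → ℕ+) : AddSubgroup (∀ j, ZMod (partialProduct n j)) where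
  carrier := {x | ∀ j, reduction n j (x (j + 1)) = x j}
  add_mem' := by
    intro a b ha hb j
    simp only [Pi.add_apply, map_add, ha j, hb j]
  zero_mem' := by
    intro j
    simp only [Pi.zero_apply, map_zero]
  neg_mem' := by
    intro a ha j
    simp only [Pi.neg_apply, map_neg, ha j]

/-- The compact group underlying the odometer given by the sequence `n`. -/
def Odometer (n : ℕ → ℕ+) : Type := odometerSubgroup n

namespace Odometer

variable (n : ℕ → ℕ+)

instance : AddCommGroup (Odometer n) := inferInstanceAs (AddCommGroup (odometerSubgroup n))

instance : TopologicalSpace (Odometer n) :=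
  inferInstanceAs (TopologicalSpace (odometerSubgroup n))

instance : IsTopologicalAddGroup (Odometer n) :=
  inferInstanceAs (IsTopologicalAddGroup (odometerSubgroup n))

instance : CompactSpace (Odometer n) := by
  have hc : IsClosed {x : ∀ j, ZMod (partialProduct n j) | ∀ j, reduction n j (x (j + 1)) = x j} := by
    rw [Set.ofPred_forall]
    refine isClosed_iInter fun j => isClosed_eq ?_ (continuous_apply j)
    exact (continuous_of_discreteTopology (f := reduction n j)).comp (continuous_apply (j + 1))
  exact isCompact_iff_compactSpace.1 hc.isCompact

instance : MeasurableSpace (Odometer n) := borel _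

instance : BorelSpace (Odometer n) := ⟨rfl⟩

/-- The image of `1 ∈ ℤ` in the inverse limit. -/
def one : Odometer n := ⟨fun _ => 1, fun _ => map_one _⟩

/-- The action of `ℤ` by translation. -/
instance : AddAction ℤ (Odometer n) where
  vadd k x := k • one n + x
  zero_vadd x := show (0 : ℤ) • one n + x = x by rw [zero_smul, zero_add]
  add_vadd k l x := show (k + l) • one n + x = k • one n + (l • one n + x) by
    rw [add_smul, add_assoc]

/-- The invariant probability measure: normalized Haar measure. -/
def haar : Measure (Odometer n) := Measure.addHaarMeasure ⊤

end Odometer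

end

/-! A point of an odometer is a coherent sequence of positions in cyclic towers whose heights are
its levels. Take levels `A k` of the `q`-odometer and `G k` of the universal one with `A k ∣ G k`
and `G (k + 1) = f k * A (k + 1)`. An interval of length `A (k + 1)` splits into consecutive blocks
of length `G k` and fewer than `G k` loose points. Joining `f k` such intervals, moving all blocks
to the front and treating each block by the permutation of the previous stage gives a permutation of
an interval of length `G (k + 1)`. Blocks now start at multiples of `G k`, so the permutations are
compatible modulo `G k` at every point lying in a block. By Borel–Cantelli almost every point does
so at all large stages, and the permutations define a map `toMap` between the odometers with a.e.
inverse `invMap`.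

If `x` stays at distance more than `|g|` from the ends of the covered windows from stage `K` on,
then `x` and `g +ᵥ x` share all their larger blocks, and the image displacement is at most `2|g| + 3
G K` (`exists_toMap_vadd`, `exists_invMap_vadd`). Failure at stage `i` has probability `O(G i / A (i
+ 1))`. Hence the cocycles have finite logarithmic moment, and so finite entropy
(`shannonEntropy_lt_top`), once `∑ G i / A (i + 1) * (1 + log G (i + 1))` converges.

This can be arranged (`exists_isFast`): `G (k + 1)` is `A (k + 1)` times a factor fixed before `A (k
+ 1)` is chosen, so its logarithm is negligible against a large `A (k + 1)`. Universality of the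
target enters because every `G k` has to divide one of its levels. -/

theorem partialProduct_dvd (n : ℕ → ℕ+) {i j : ℕ} (h : i ≤ j) :
    partialProduct n i ∣ partialProduct n j := by
  induction h with
  | refl => exact dvd_rfl
  | step _ ih => exact ih.trans (partialProduct_dvd_succ n _)

/-! ### Residues of points of an odometer, and gluing of compatible residues. -/

namespace Odometer

variable {n : ℕ → ℕ+}

/-- The image of a point of the odometer in `ℤ/(n 0 ⋯ n (j - 1))ℤ`. -/
def coord (x : Odometer n) (j : ℕ) : ZMod (partialProduct n j) := x.1 j

/-- The point of the odometer with given coordinates. -/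
def ofCoord (f : ∀ j, ZMod (partialProduct n j)) (h : ∀ j, reduction n j (f (j + 1)) = f j) :
    Odometer n := ⟨f, h⟩

theorem coord_ofCoord (f : ∀ j, ZMod (partialProduct n j))
    (h : ∀ j, reduction n j (f (j + 1)) = f j) (j : ℕ) : coord (ofCoord f h) j = f j := rfl

theorem ext_coord {x y : Odometer n} (h : ∀ j, coord x j = coord y j) : x = y :=
  Subtype.ext (funext h)

theorem cast_coord (x : Odometer n) {i j : ℕ} (h : i ≤ j) :
    ZMod.castHom (partialProduct_dvd n h) (ZMod (partialProduct n i)) (coord x j) = coord x i := by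
  induction h with
  | refl => simp
  | @step m h ih =>
    have hx : reduction n m (coord x (m + 1)) = coord x m := x.2 m
    rw [← ih, ← hx, reduction, ← RingHom.comp_apply, ZMod.castHom_comp]

theorem coord_vadd (g : ℤ) (x : Odometer n) (j : ℕ) :
    coord (g +ᵥ x) j = g + coord x j := by
  change (g • (1 : ZMod (partialProduct n j))) + coord x j = _
  simp

theorem val_coord_mod (x : Odometer n) {i j : ℕ} (h : i ≤ j) :
    (coord x j).val % partialProduct n i = (coord x i).val := by
  rw [← cast_coord x h, ZMod.castHom_apply, ZMod.cast_eq_val, ZMod.val_natCast]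

/-- The residue modulo `M` of a point of the odometer, for `M` dividing one of its levels. -/
noncomputable def residue (x : Odometer n) (M : ℕ) : ℕ :=
  open Classical in if h : ∃ j, M ∣ partialProduct n j then (coord x (Nat.find h)).val % M else 0

theorem residue_eq (x : Odometer n) {M j : ℕ} (h : M ∣ partialProduct n j) :
    residue x M = (coord x j).val % M := by
  classical
  have h' : ∃ j, M ∣ partialProduct n j := ⟨j, h⟩
  rw [residue, dif_pos h', ← val_coord_mod x (Nat.find_min' h' h),
    Nat.mod_mod_of_dvd _ (Nat.find_spec h')]

theorem residue_lt (x : Odometer n) {M : ℕ} (h : ∃ j, M ∣ partialProduct n j) :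
    residue x M < M := by
  obtain ⟨j, hj⟩ := h
  rw [residue_eq x hj]
  exact Nat.mod_lt _ (Nat.pos_of_dvd_of_pos hj (NeZero.pos _))

theorem residue_mod (x : Odometer n) {M M' : ℕ} (h : ∃ j, M ∣ partialProduct n j)
    (h' : M' ∣ M) : residue x M % M' = residue x M' := by
  obtain ⟨j, hj⟩ := h
  rw [residue_eq x hj, residue_eq x (h'.trans hj), Nat.mod_mod_of_dvd _ h']

theorem residue_vadd (g : ℤ) (x : Odometer n) {M : ℕ} (h : ∃ j, M ∣ partialProduct n j) :
    (residue (g +ᵥ x) M : ℤ) = (residue x M + g) % M := by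
  obtain ⟨j, hj⟩ := h
  have e : (((coord (g +ᵥ x) j).val : ℤ)) ≡ (coord x j).val + g [ZMOD partialProduct n j] := by
    rw [← ZMod.intCast_eq_intCast_iff]
    simp [coord_vadd, add_comm]
  have e' := e.of_dvd (Int.natCast_dvd_natCast.2 hj)
  rw [residue_eq _ hj, residue_eq _ hj]
  push_cast
  rw [e', Int.emod_add_emod]

/-- Without wrap-around, translation is integer addition on residues; the windows used later serve
to guarantee this. -/
theorem residue_vadd_of_mem (g : ℤ) (x : Odometer n) {M : ℕ} (h : ∃ j, M ∣ partialProduct n j)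
    (h0 : 0 ≤ residue x M + g) (h1 : residue x M + g < M) :
    (residue (g +ᵥ x) M : ℤ) = residue x M + g := by
  rw [residue_vadd g x h, Int.emod_eq_of_lt h0 h1]

theorem continuous_coord (j : ℕ) : Continuous (fun x : Odometer n => coord x j) :=
  (continuous_apply j).comp continuous_subtype_val

theorem measurable_residue (M : ℕ) : Measurable (fun x : Odometer n => residue x M) := by
  classical
  by_cases h : ∃ j, M ∣ partialProduct n j
  · obtain ⟨j, hj⟩ := h
    have : (fun x : Odometer n => residue x M) = fun x => (coord x j).val % M :=
      funext fun x => residue_eq x hj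
    rw [this]
    exact ((continuous_of_discreteTopology (f := fun a : ZMod (partialProduct n j) =>
      a.val % M)).comp (continuous_coord j)).measurable
  · have : (fun x : Odometer n => residue x M) = fun _ => 0 := by
      funext x
      rw [residue, dif_neg h]
    rw [this]
    exact measurable_const

theorem measurableSet_residue_eq (M b : ℕ) : MeasurableSet {x : Odometer n | residue x M = b} :=
  measurable_residue M (MeasurableSet.of_discrete (s := {b}))

/-- Divisibility chains defining the same profinite group as the levels of the odometer. -/
structure IsCofinal (n : ℕ → ℕ+) (L : ℕ → ℕ) : Prop where
  dvd_succ : ∀ k, L k ∣ L (k + 1)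
  level_dvd : ∀ k, partialProduct n k ∣ L k
  dvd_level : ∀ k, ∃ j, L k ∣ partialProduct n j

namespace IsCofinal

variable {L : ℕ → ℕ}

theorem dvd (hL : IsCofinal n L) {i j : ℕ} (h : i ≤ j) : L i ∣ L j := by
  induction h with
  | refl => exact dvd_rfl
  | step _ ih => exact ih.trans (hL.dvd_succ _)

theorem pos (hL : IsCofinal n L) (k : ℕ) : 0 < L k := by
  obtain ⟨j, hj⟩ := hL.dvd_level k
  exact Nat.pos_of_dvd_of_pos hj (NeZero.pos _)

theorem ext (hL : IsCofinal n L) {x y : Odometer n} (K : ℕ)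
    (h : ∀ k, K ≤ k → residue x (L k) = residue y (L k)) : x = y := by
  refine ext_coord fun j => ZMod.val_injective _ ?_
  have hd : partialProduct n j ∣ L (max K j) :=
    (hL.level_dvd j).trans (hL.dvd (le_max_right _ _))
  have e := congrArg (· % partialProduct n j) (h (max K j) (le_max_left _ _))
  simp only [residue_mod _ (hL.dvd_level _) hd] at e
  rwa [residue_eq x dvd_rfl, residue_eq y dvd_rfl, Nat.mod_eq_of_lt (ZMod.val_lt _),
    Nat.mod_eq_of_lt (ZMod.val_lt _)] at e

theorem modEq_of_le (hL : IsCofinal n L) {z : ℕ → ℕ} {K : ℕ}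
    (h : ∀ k, K ≤ k → z (k + 1) ≡ z k [MOD L k]) {i j : ℕ} (hi : K ≤ i) (hij : i ≤ j) :
    z j ≡ z i [MOD L i] := by
  induction hij with
  | refl => rfl
  | @step m hm ih => exact ((h m (hi.trans hm)).of_dvd (hL.dvd hm)).trans ih

open Classical in
/-- The point of the odometer with prescribed eventually compatible residues. -/
noncomputable def glue (hL : IsCofinal n L) (z : ℕ → ℕ) : Odometer n :=
  -- Compatibility is asked only from some `K` on, since a typical point is good only beyond a stage
  -- depending on it. The value `0` elsewhere keeps the map total and measurable.
  if h : ∃ K, ∀ k, K ≤ k → z (k + 1) ≡ z k [MOD L k] then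
    ofCoord (fun j => (z (max (Nat.find h) j) : ZMod (partialProduct n j))) fun j => by
      rw [map_natCast, ZMod.natCast_eq_natCast_iff]
      exact (hL.modEq_of_le (Nat.find_spec h) (le_max_left _ _)
        (max_le_max_left _ j.le_succ)).of_dvd
          ((hL.level_dvd j).trans (hL.dvd (le_max_right _ _)))
  else 0

theorem coord_glue (hL : IsCofinal n L) {z : ℕ → ℕ} {K : ℕ}
    (h : ∀ k, K ≤ k → z (k + 1) ≡ z k [MOD L k]) {j k : ℕ} (hK : K ≤ k) (hj : j ≤ k) :
    coord (hL.glue z) j = z k := by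
  classical
  have h' : ∃ K, ∀ k, K ≤ k → z (k + 1) ≡ z k [MOD L k] := ⟨K, h⟩
  have e : coord (hL.glue z) j = (z (max (Nat.find h') j) : ZMod (partialProduct n j)) := by
    rw [glue, dif_pos h', coord_ofCoord]
  rw [e, ZMod.natCast_eq_natCast_iff]
  exact (hL.modEq_of_le (Nat.find_spec h') (le_max_left _ _)
    (max_le ((Nat.find_min' h' h).trans hK) hj)).symm.of_dvd
      ((hL.level_dvd j).trans (hL.dvd (le_max_right _ _)))

theorem residue_glue (hL : IsCofinal n L) {z : ℕ → ℕ} {K : ℕ}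
    (h : ∀ k, K ≤ k → z (k + 1) ≡ z k [MOD L k]) {k : ℕ} (hK : K ≤ k) :
    residue (hL.glue z) (L k) = z k % L k := by
  obtain ⟨j, hj⟩ := hL.dvd_level k
  rw [residue_eq _ hj, hL.coord_glue h (k := max j k) (hK.trans (le_max_right _ _))
    (le_max_left _ _), ZMod.val_natCast, Nat.mod_mod_of_dvd _ hj]
  exact hL.modEq_of_le h hK (le_max_right _ _)

end IsCofinal

/-! ### Borel structure and Haar measure. -/

instance : SecondCountableTopology (Odometer n) :=
  have (j : ℕ) : SecondCountableTopology (ZMod (partialProduct n j)) :=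
    have : Countable (ZMod (partialProduct n j)) := Finite.to_countable
    inferInstance
  TopologicalSpace.Subtype.secondCountableTopology
    (odometerSubgroup n : Set (∀ j, ZMod (partialProduct n j)))

instance : T2Space (Odometer n) := inferInstanceAs (T2Space (odometerSubgroup n))

theorem measurableSpace_eq_iSup :
    instMeasurableSpace n =
      ⨆ j, MeasurableSpace.comap (fun x : Odometer n => coord x j) ⊤ := by
  have (j : ℕ) : SecondCountableTopology (ZMod (partialProduct n j)) :=
    have : Countable (ZMod (partialProduct n j)) := Finite.to_countable
    inferInstance
  let (j : ℕ) : MeasurableSpace (ZMod (partialProduct n j)) := ⊤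
  have (j : ℕ) : BorelSpace (ZMod (partialProduct n j)) := ⟨borel_eq_top_of_discrete.symm⟩
  have h := (inferInstance : BorelSpace (odometerSubgroup n)).measurable_eq
  change borel (odometerSubgroup n) = _
  rw [← h]
  change MeasurableSpace.comap _ (⨆ j, MeasurableSpace.comap _ _) = _
  rw [MeasurableSpace.comap_iSup]
  simp only [MeasurableSpace.comap_comp]
  rfl

theorem measurable_of_coord {α : Type*} [MeasurableSpace α] {f : α → Odometer n}
    (h : ∀ j a, MeasurableSet {x | coord (f x) j = a}) : Measurable f := by
  rw [measurable_iff_comap_le, measurableSpace_eq_iSup, MeasurableSpace.comap_iSup]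
  refine iSup_le fun j => ?_
  rw [MeasurableSpace.comap_comp, ← measurable_iff_comap_le]
  let : MeasurableSpace (ZMod (partialProduct n j)) := ⊤
  exact measurable_to_countable' fun a => h j a

theorem IsCofinal.measurable_glue {L : ℕ → ℕ} (hL : IsCofinal n L) : Measurable hL.glue := by
  classical
  refine measurable_of_coord fun j a => ?_
  have hmod (M k : ℕ) : MeasurableSet {z : ℕ → ℕ | z (k + 1) ≡ z k [MOD M]} :=
    measurableSet_eq_fun ((measurable_from_nat (f := fun a => a % M)).comp (measurable_pi_apply _))
      ((measurable_from_nat (f := fun a => a % M)).comp (measurable_pi_apply _))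
  have hc (K : ℕ) : MeasurableSet {z : ℕ → ℕ | ∀ k, K ≤ k → z (k + 1) ≡ z k [MOD L k]} := by
    have : {z : ℕ → ℕ | ∀ k, K ≤ k → z (k + 1) ≡ z k [MOD L k]} =
        ⋂ k, ⋂ (_ : K ≤ k), {z : ℕ → ℕ | z (k + 1) ≡ z k [MOD L k]} := by
      ext z; simp
    rw [this]
    exact MeasurableSet.iInter fun k => MeasurableSet.iInter fun _ => hmod _ _
  have hv (k : ℕ) : MeasurableSet {z : ℕ → ℕ | (z k : ZMod (partialProduct n j)) = a} :=
    (measurable_pi_apply (X := fun _ : ℕ => ℕ) k)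
      (MeasurableSet.of_discrete (s := {b : ℕ | (b : ZMod (partialProduct n j)) = a}))
  -- By `coord_glue` the coordinate may be read off with any valid threshold, so the least one,
  -- hidden in `glue`, is replaced by a countable union over thresholds.
  have e : {z | coord (hL.glue z) j = a} =
      (⋃ K, {z : ℕ → ℕ | ∀ k, K ≤ k → z (k + 1) ≡ z k [MOD L k]} ∩
        {z : ℕ → ℕ | (z (max K j) : ZMod (partialProduct n j)) = a}) ∪
      ((⋃ K, {z : ℕ → ℕ | ∀ k, K ≤ k → z (k + 1) ≡ z k [MOD L k]})ᶜ ∩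
        {_z : ℕ → ℕ | coord (0 : Odometer n) j = a}) := by
    ext z
    by_cases h : ∃ K, ∀ k, K ≤ k → z (k + 1) ≡ z k [MOD L k]
    · obtain ⟨K, hK⟩ := id h
      have h1 : z ∈ ⋃ K, {z : ℕ → ℕ | ∀ k, K ≤ k → z (k + 1) ≡ z k [MOD L k]} :=
        Set.mem_iUnion.2 ⟨K, hK⟩
      simp only [Set.mem_union, Set.mem_inter_iff, Set.mem_compl_iff, h1, not_true_eq_false,
        false_and, or_false, Set.mem_iUnion, Set.mem_ofPred_eq]
      constructor
      · intro hz
        exact ⟨K, hK, by rw [← hL.coord_glue hK (le_max_left _ _) (le_max_right _ _)]; exact hz⟩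
      · rintro ⟨K', hK', e⟩
        rw [hL.coord_glue hK' (le_max_left _ _) (le_max_right _ _)]
        exact e
    · have h1 (K : ℕ) : ¬ ∀ k, K ≤ k → z (k + 1) ≡ z k [MOD L k] := fun hK => h ⟨K, hK⟩
      simp only [Set.mem_union, Set.mem_inter_iff, Set.mem_compl_iff, Set.mem_iUnion,
        Set.mem_ofPred_eq, IsCofinal.glue, dif_neg h]
      constructor
      · intro hz
        exact Or.inr ⟨fun ⟨K, hK⟩ => h1 K hK, hz⟩
      · rintro (⟨K, hK, -⟩ | ⟨-, hz⟩)
        · exact absurd hK (h1 K)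
        · exact hz
  rw [e]
  exact (MeasurableSet.iUnion fun K => (hc K).inter (hv _)).union
    ((MeasurableSet.iUnion fun K => hc K).compl.inter (MeasurableSet.const _))

instance : IsProbabilityMeasure (haar n) :=
  ⟨by
    simpa [haar] using Measure.addHaarMeasure_self
      (K₀ := (⊤ : TopologicalSpace.PositiveCompacts (Odometer n)))⟩

theorem measurePreserving_vadd (g : ℤ) :
    MeasurePreserving (fun x : Odometer n => g +ᵥ x) (haar n) (haar n) := by
  have : (haar n).IsAddLeftInvariant := by unfold haar; infer_instance
  exact MeasureTheory.measurePreserving_add_left (haar n) (g • one n)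

/-- Translations permute the `M` residue classes transitively, so they share the total mass equally.
-/
theorem haar_residue_eq {M a : ℕ} (h : ∃ j, M ∣ partialProduct n j) (ha : a < M) :
    haar n {x | residue x M = a} = (M : ℝ≥0∞)⁻¹ := by
  have hm := measurableSet_residue_eq (n := n) M
  have key (b : ℕ) (hb : b < M) :
      haar n {x | residue x M = b} = haar n {x | residue x M = 0} := by
    rw [← (measurePreserving_vadd (n := n) b).measure_preimage (hm b).nullMeasurableSet]
    congr 1
    ext x
    have e := residue_vadd b x h
    have hx := residue_lt x h
    simp only [Set.mem_preimage, Set.mem_ofPred_eq]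
    norm_cast at e
    rw [e]
    constructor
    · intro h'
      by_contra h0
      rcases lt_or_ge (residue x M + b) M with hlt | hge
      · rw [Nat.mod_eq_of_lt hlt] at h'; omega
      · rw [Nat.mod_eq_sub_mod hge, Nat.mod_eq_of_lt (by omega)] at h'; omega
    · intro h'
      rw [h', zero_add, Nat.mod_eq_of_lt hb]
  have hsum : ∑ b ∈ Finset.range M, haar n {x | residue x M = b} = 1 := by
    rw [← measure_biUnion_finset (fun i _ j _ hij => Set.disjoint_left.2 fun x hx hx' =>
      hij (hx.symm.trans hx')) (fun b _ => hm b), ← measure_univ (μ := haar n)]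
    congr 1
    ext x
    simp [residue_lt x h]
  rw [Finset.sum_congr rfl (fun b hb => key b (Finset.mem_range.1 hb)), Finset.sum_const,
    Finset.card_range, nsmul_eq_mul] at hsum
  rw [key a ha]
  exact ENNReal.eq_inv_of_mul_eq_one_left (by rwa [mul_comm])

theorem haar_residue_mem_le {M : ℕ} (h : ∃ j, M ∣ partialProduct n j) (S : Finset ℕ)
    (hS : ∀ a ∈ S, a < M) : haar n {x | residue x M ∈ S} ≤ S.card / M := by
  have e : {x : Odometer n | residue x M ∈ S} = ⋃ a ∈ S, {x | residue x M = a} := by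
    ext x; simp
  rw [e]
  refine (measure_biUnion_finset_le _ _).trans_eq ?_
  rw [Finset.sum_congr rfl (fun a ha => haar_residue_eq h (hS a ha))]
  simp [div_eq_mul_inv]

theorem eq_zero_of_vadd_eq (h : ∀ B : ℕ, ∃ j, B < partialProduct n j) {g : ℤ} {x : Odometer n}
    (hg : g +ᵥ x = x) : g = 0 := by
  obtain ⟨j, hj⟩ := h g.natAbs
  have e : (g : ZMod (partialProduct n j)) = 0 := by
    have := coord_vadd g x j
    rw [hg] at this
    simpa using this
  rw [ZMod.intCast_zmod_eq_zero_iff_dvd] at e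
  exact Int.eq_zero_of_dvd_of_natAbs_lt_natAbs e (by simpa using hj)

theorem isFreePMPAction (h : ∀ B : ℕ, ∃ j, B < partialProduct n j) :
    IsFreePMPAction ℤ (haar n) where
  isProbabilityMeasure := inferInstance
  measurePreserving := measurePreserving_vadd
  free := Filter.Eventually.of_forall fun _ _ hg => eq_zero_of_vadd_eq h hg

/-- A probability measure giving cylinder sets at most their Haar measure is the Haar measure. -/
theorem IsCofinal.eq_haar {L : ℕ → ℕ} (hL : IsCofinal n L) (μ : Measure (Odometer n))
    [IsProbabilityMeasure μ]
    (h : ∀ k a, a < L k → μ {x | residue x (L k) = a} ≤ (L k : ℝ≥0∞)⁻¹) : μ = haar n := by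
  have hm := measurableSet_residue_eq (n := n)
  -- The `L k` cylinders have total mass `1`, so none can fall short of its upper bound.
  have heq (k a : ℕ) (ha : a < L k) : μ {x | residue x (L k) = a} = (L k : ℝ≥0∞)⁻¹ := by
    refine le_antisymm (h k a ha) ?_
    by_contra hlt
    rw [not_le] at hlt
    have hsum : ∑ b ∈ Finset.range (L k), μ {x | residue x (L k) = b} = 1 := by
      rw [← measure_biUnion_finset (fun i _ j _ hij => Set.disjoint_left.2 fun x hx hx' =>
        hij (hx.symm.trans hx')) (fun b _ => hm _ b), ← measure_univ (μ := μ)]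
      congr 1
      ext x
      simp [residue_lt x (hL.dvd_level k)]
    have hlt' := ENNReal.sum_lt_sum_of_nonempty (s := {a}) (by simp)
      (f := fun b => μ {x | residue x (L k) = b}) (g := fun _ => (L k : ℝ≥0∞)⁻¹)
      (by simpa using hlt)
    have hle : ∑ b ∈ (Finset.range (L k)).erase a, μ {x | residue x (L k) = b} ≤
        ∑ b ∈ (Finset.range (L k)).erase a, (L k : ℝ≥0∞)⁻¹ :=
      Finset.sum_le_sum fun b hb => h k b (Finset.mem_range.1 (Finset.mem_of_mem_erase hb))
    have hfin : ∑ b ∈ (Finset.range (L k)).erase a, μ {x | residue x (L k) = b} ≠ ∞ :=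
      ENNReal.sum_ne_top.2 fun b _ => measure_ne_top _ _
    have := ENNReal.add_lt_add_of_le_of_lt hfin hle (by simpa using hlt')
    rw [Finset.sum_erase_add _ _ (Finset.mem_range.2 ha), hsum] at this
    have h2 := Finset.sum_erase_add (Finset.range (L k)) (fun _ => (L k : ℝ≥0∞)⁻¹)
      (Finset.mem_range.2 ha)
    rw [h2] at this
    have hpos : (L k : ℝ≥0∞) ≠ 0 := by exact_mod_cast (hL.pos k).ne'
    simp [ENNReal.mul_inv_cancel hpos] at this
  let C : Set (Set (Odometer n)) := {s | ∃ k a, a < L k ∧ s = {x | residue x (L k) = a}}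
  refine ext_of_generate_finite C ?_ ?_ ?_ (by simp)
  · refine le_antisymm ?_ ?_
    · rw [measurableSpace_eq_iSup]
      refine iSup_le fun j => ?_
      rw [← measurable_iff_comap_le]
      have hr : Measurable[MeasurableSpace.generateFrom C]
          (fun x : Odometer n => residue x (L j)) := by
        refine @measurable_to_countable' ℕ _ _ _ (MeasurableSpace.generateFrom C) _ fun b => ?_
        by_cases hb : b < L j
        · exact MeasurableSpace.measurableSet_generateFrom ⟨j, b, hb, rfl⟩
        · have : (fun x : Odometer n => residue x (L j)) ⁻¹' {b} = ∅ := by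
            ext x
            have := residue_lt x (hL.dvd_level j)
            simp only [Set.mem_preimage, Set.mem_singleton_iff, Set.mem_empty_iff_false, iff_false]
            omega
          rw [this]
          exact @MeasurableSet.empty _ (MeasurableSpace.generateFrom C)
      have e : (fun x : Odometer n => coord x j) =
          (fun b : ℕ => (b : ZMod (partialProduct n j))) ∘ fun x => residue x (L j) := by
        funext x
        have := residue_mod x (hL.dvd_level j) (hL.level_dvd j)
        rw [residue_eq x (dvd_refl (partialProduct n j)), Nat.mod_eq_of_lt (ZMod.val_lt _)] at this
        simp only [Function.comp]
        rw [← ZMod.natCast_mod, this, ZMod.natCast_zmod_val]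
      rw [e]
      exact (@measurable_from_nat _ ⊤ _).comp hr
    · refine MeasurableSpace.generateFrom_le ?_
      rintro _ ⟨k, a, -, rfl⟩
      exact hm _ _
  -- Cylinders form a π-system: along a divisibility chain two of them that meet are nested.
  · rintro _ ⟨k, a, ha, rfl⟩ _ ⟨l, b, hb, rfl⟩ ⟨x, hx, hx'⟩
    simp only [Set.mem_ofPred_eq] at hx hx'
    rcases le_total k l with hkl | hkl
    · refine ⟨l, b, hb, ?_⟩
      ext y
      simp only [Set.mem_inter_iff, Set.mem_ofPred_eq, and_iff_right_iff_imp]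
      intro hy
      rw [← residue_mod y (hL.dvd_level l) (hL.dvd hkl), hy, ← hx',
        residue_mod x (hL.dvd_level l) (hL.dvd hkl), hx]
    · refine ⟨k, a, ha, ?_⟩
      ext y
      simp only [Set.mem_inter_iff, Set.mem_ofPred_eq, and_iff_left_iff_imp]
      intro hy
      rw [← residue_mod y (hL.dvd_level k) (hL.dvd hkl), hy, ← hx,
        residue_mod x (hL.dvd_level k) (hL.dvd hkl), hx']
  · rintro _ ⟨k, a, ha, rfl⟩
    rw [heq k a ha, haar_residue_eq (hL.dvd_level k) ha]

end Odometer

/-! ### Rearranging an interval -/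

/-- An interval of length `f * A` is a concatenation of `f` intervals of length `A`. Each of these
begins with `A / G` blocks of length `G` and ends with `A % G` loose points. The rearrangement puts
all the blocks first, applying `σ` in each of them, and then all the loose points. -/
def rearrange (A G f : ℕ) (σ : ℕ → ℕ) (t : ℕ) : ℕ :=
  if t % A < A / G * G then (t / A * (A / G) + t % A / G) * G + σ (t % A % G)
  else f * (A / G) * G + t / A * (A % G) + (t % A - A / G * G)

/-- The inverse of `rearrange A G f σ` if `τ` is the inverse of `σ`. -/
def unrearrange (A G f : ℕ) (τ : ℕ → ℕ) (s : ℕ) : ℕ :=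
  if s < f * (A / G) * G then s / G / (A / G) * A + s / G % (A / G) * G + τ (s % G)
  else (s - f * (A / G) * G) / (A % G) * A + A / G * G + (s - f * (A / G) * G) % (A % G)

section

variable {A G f : ℕ} {σ τ : ℕ → ℕ}

theorem rearrange_of_lt {t : ℕ} (h : t % A < A / G * G) :
    rearrange A G f σ t = (t / A * (A / G) + t % A / G) * G + σ (t % A % G) := if_pos h

theorem unrearrange_of_lt {s : ℕ} (h : s < f * (A / G) * G) :
    unrearrange A G f τ s = s / G / (A / G) * A + s / G % (A / G) * G + τ (s % G) := if_pos h

theorem div_mod_of_eq {q r d a : ℕ} (h : a = q * d + r) (hr : r < d) : a / d = q ∧ a % d = r := by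
  subst h
  rw [mul_comm, Nat.mul_add_div (by omega), Nat.div_eq_of_lt hr, Nat.mul_add_mod,
    Nat.mod_eq_of_lt hr]
  simp

theorem block_lt {q r d m : ℕ} (hq : q < m) (hr : r < d) : q * d + r < m * d :=
  calc q * d + r < q * d + d := by omega
    _ = (q + 1) * d := by ring
    _ ≤ m * d := Nat.mul_le_mul_right _ hq

/-- Blocks fill exactly the initial part and loose points come after it, so the branch taken by
`rearrange` can be recognised from its value. -/
theorem rearrange_lt_iff (hG : 0 < G) (hσ : ∀ t < G, σ t < G) {t : ℕ} (ht : t < f * A) :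
    rearrange A G f σ t < f * (A / G) * G ↔ t % A < A / G * G := by
  constructor
  · intro h
    by_contra h'
    rw [rearrange, if_neg h'] at h
    omega
  · intro h
    rw [rearrange_of_lt h]
    have hA : 0 < A := Nat.pos_of_ne_zero (by rintro rfl; simp at ht)
    exact block_lt (block_lt ((Nat.div_lt_iff_lt_mul hA).2 ht)
      ((Nat.div_lt_iff_lt_mul hG).2 h)) (hσ _ (Nat.mod_lt _ hG))

theorem rearrange_lt (hG : 0 < G) (hσ : ∀ t < G, σ t < G) {t : ℕ} (ht : t < f * A) :
    rearrange A G f σ t < f * A := by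
  have hA : 0 < A := Nat.pos_of_ne_zero (by rintro rfl; simp at ht)
  have e : f * A = f * (A / G) * G + f * (A % G) := by
    conv_lhs => rw [← Nat.div_add_mod A G]
    ring
  by_cases h : t % A < A / G * G
  · have := (rearrange_lt_iff (f := f) hG hσ ht).2 h
    omega
  · rw [rearrange, if_neg h]
    have h1 : t % A - A / G * G < A % G := by
      have := Nat.mod_lt t hA
      have := Nat.div_add_mod' A G
      omega
    have := block_lt ((Nat.div_lt_iff_lt_mul hA).2 ht) h1
    omega

theorem unrearrange_rearrange (hG : 0 < G) (hσ : ∀ t < G, σ t < G) (hτσ : ∀ t < G, τ (σ t) = t)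
    {t : ℕ} (ht : t < f * A) : unrearrange A G f τ (rearrange A G f σ t) = t := by
  have hA : 0 < A := Nat.pos_of_ne_zero (by rintro rfl; simp at ht)
  have h0 := rearrange_lt_iff hG hσ ht
  by_cases h : t % A < A / G * G
  · rw [unrearrange_of_lt (h0.2 h)]
    have h1 := div_mod_of_eq (rearrange_of_lt (f := f) (σ := σ) h) (hσ _ (Nat.mod_lt _ hG))
    have h2 := div_mod_of_eq h1.1 ((Nat.div_lt_iff_lt_mul hG).2 h)
    rw [h2.1, h2.2, h1.2, hτσ _ (Nat.mod_lt _ hG), add_assoc, Nat.div_add_mod', Nat.div_add_mod']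
  · rw [unrearrange, if_neg (fun h' => h (h0.1 h')), rearrange, if_neg h]
    have h1 : t % A - A / G * G < A % G := by
      have := Nat.mod_lt t hA
      have := Nat.div_add_mod' A G
      omega
    have h2 := div_mod_of_eq rfl h1 (q := t / A)
    rw [add_assoc (f * (A / G) * G), Nat.add_sub_cancel_left, h2.1, h2.2]
    have := Nat.div_add_mod' t A
    omega

theorem unrearrange_lt (hG : 0 < G) (hτ : ∀ t < G, τ t < G) {s : ℕ} (hs : s < f * A) :
    unrearrange A G f τ s < f * A := by
  have e : f * A = f * (A / G) * G + f * (A % G) := by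
    conv_lhs => rw [← Nat.div_add_mod A G]
    ring
  have eA := Nat.div_add_mod' A G
  by_cases h : s < f * (A / G) * G
  · have hc := (Nat.div_lt_iff_lt_mul hG).2 h
    have hm : 0 < A / G := Nat.pos_of_ne_zero (by intro h'; simp [h'] at h)
    rw [unrearrange_of_lt h, add_assoc]
    refine block_lt ((Nat.div_lt_iff_lt_mul hm).2 hc) ?_
    have := block_lt (Nat.mod_lt (s / G) hm) (hτ _ (Nat.mod_lt s hG))
    omega
  · have hR : 0 < A % G := Nat.pos_of_ne_zero (by intro h'; simp [h'] at e; omega)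
    have := Nat.mod_lt (s - f * (A / G) * G) hR
    rw [unrearrange, if_neg h, add_assoc]
    exact block_lt ((Nat.div_lt_iff_lt_mul hR).2 (by omega)) (by omega)

theorem rearrange_unrearrange (hG : 0 < G) (hτ : ∀ t < G, τ t < G) (hστ : ∀ t < G, σ (τ t) = t)
    {s : ℕ} (hs : s < f * A) : rearrange A G f σ (unrearrange A G f τ s) = s := by
  have e : f * A = f * (A / G) * G + f * (A % G) := by
    conv_lhs => rw [← Nat.div_add_mod A G]
    ring
  have eA := Nat.div_add_mod' A G
  by_cases h : s < f * (A / G) * G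
  · have hm : 0 < A / G := Nat.pos_of_ne_zero (by intro h'; simp [h'] at h)
    have h3 := block_lt (Nat.mod_lt (s / G) hm) (hτ _ (Nat.mod_lt s hG))
    have e1 := unrearrange_of_lt (τ := τ) h
    rw [add_assoc] at e1
    have h1 := div_mod_of_eq e1 (by omega)
    have h2 := div_mod_of_eq h1.2 (hτ _ (Nat.mod_lt s hG))
    rw [rearrange_of_lt (by rw [h1.2]; exact h3), h2.1, h2.2, h1.1, hστ _ (Nat.mod_lt s hG),
      Nat.div_add_mod', Nat.div_add_mod']
  · have hR : 0 < A % G := Nat.pos_of_ne_zero (by intro h'; simp [h'] at e; omega)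
    have h3 := Nat.mod_lt (s - f * (A / G) * G) hR
    have e1 : unrearrange A G f τ s = (s - f * (A / G) * G) / (A % G) * A +
        (A / G * G + (s - f * (A / G) * G) % (A % G)) := by
      rw [unrearrange, if_neg h, add_assoc]
    have h1 := div_mod_of_eq e1 (by omega)
    rw [rearrange, if_neg (by rw [h1.2]; omega), h1.1, h1.2, Nat.add_sub_cancel_left, add_assoc,
      Nat.div_add_mod']
    omega

end

/-! ### The rearrangement map between two odometers -/

/-- If numbers and remainders move by the same amount, no multiple of `A` has been crossed. -/
theorem div_eq_div_of_mod_add {a a' b b' A : ℕ} {g : ℤ} (h : a % A = b) (h' : a' % A = b')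
    (ha : (a' : ℤ) = a + g) (hb : (b' : ℤ) = b + g) : a' / A = a / A := by
  rcases Nat.eq_zero_or_pos A with rfl | hA
  · simp
  have e := Nat.div_add_mod a A
  have e' := Nat.div_add_mod a' A
  zify at h h' e e' ⊢
  have : (A : ℤ) * (a' / A - a / A) = 0 := by linarith
  rcases mul_eq_zero.1 this with h0 | h0
  · omega
  · omega

theorem abs_div_sub_div_mul_le {a a' G : ℕ} {g : ℤ} (ha : (a' : ℤ) = a + g) (hG : 0 < G) :
    |((a' / G : ℕ) : ℤ) - (a / G : ℕ)| * G ≤ |g| + G := by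
  have e := Nat.div_add_mod a G
  have e' := Nat.div_add_mod a' G
  have l := Nat.mod_lt a hG
  have l' := Nat.mod_lt a' hG
  rw [← Nat.abs_cast G, ← abs_mul]
  have h : (((a' / G : ℕ) - (a / G : ℕ)) * G : ℤ) = g + (a % G : ℕ) - (a' % G : ℕ) := by
    zify at e e'
    push_cast
    linarith
  rw [h, Nat.abs_cast]
  refine abs_le.2 ⟨?_, ?_⟩
  · have := neg_abs_le g; omega
  · have := le_abs_self g; omega

/-- The data of the rearrangements: blocks of length `G k` are rearranged in intervals of length
`G (k + 1) = f k * A (k + 1)`. -/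
structure RearrangementScheme (n u : ℕ → ℕ+) where
  A : ℕ → ℕ
  G : ℕ → ℕ
  f : ℕ → ℕ
  cofinal_A : Odometer.IsCofinal n A
  cofinal_G : Odometer.IsCofinal u G
  G_succ : ∀ k, G (k + 1) = f k * A (k + 1)
  A_dvd_G : ∀ k, A k ∣ G k

namespace RearrangementScheme

open Odometer

variable {n u : ℕ → ℕ+} (S : RearrangementScheme n u)

/-- The rearrangement of an interval of length `G k`. -/
def perm : ℕ → ℕ → ℕ
  | 0 => id
  | k + 1 => rearrange (S.A (k + 1)) (S.G k) (S.f k) (perm k)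

/-- The inverse of `S.perm k`. -/
def invPerm : ℕ → ℕ → ℕ
  | 0 => id
  | k + 1 => unrearrange (S.A (k + 1)) (S.G k) (S.f k) (invPerm k)

theorem G_pos (k : ℕ) : 0 < S.G k := S.cofinal_G.pos k

theorem perm_lt (k : ℕ) : ∀ t < S.G k, S.perm k t < S.G k := by
  induction k with
  | zero => exact fun t ht => ht
  | succ k ih =>
    intro t ht
    rw [S.G_succ] at ht ⊢
    exact rearrange_lt (S.G_pos k) ih ht

theorem invPerm_lt (k : ℕ) : ∀ t < S.G k, S.invPerm k t < S.G k := by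
  induction k with
  | zero => exact fun t ht => ht
  | succ k ih =>
    intro t ht
    rw [S.G_succ] at ht ⊢
    exact unrearrange_lt (S.G_pos k) ih ht

theorem invPerm_perm (k : ℕ) : ∀ t < S.G k, S.invPerm k (S.perm k t) = t := by
  induction k with
  | zero => exact fun t _ => rfl
  | succ k ih =>
    intro t ht
    rw [S.G_succ] at ht
    exact unrearrange_rearrange (S.G_pos k) (S.perm_lt k) ih ht

theorem perm_invPerm (k : ℕ) : ∀ t < S.G k, S.perm k (S.invPerm k t) = t := by
  induction k with
  | zero => exact fun t _ => rfl
  | succ k ih =>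
    intro t ht
    rw [S.G_succ] at ht
    exact rearrange_unrearrange (S.G_pos k) (S.invPerm_lt k) ih ht

/-- The length of the part covered by blocks of length `G k` in an interval of length
`A (k + 1)`. -/
def coveredA (k : ℕ) : ℕ := S.A (k + 1) / S.G k * S.G k

/-- The length of the part covered by blocks of length `G k` in an interval of length
`G (k + 1)`. -/
def coveredG (k : ℕ) : ℕ := S.f k * (S.A (k + 1) / S.G k) * S.G k

theorem coveredA_le (i : ℕ) : S.coveredA i ≤ S.A (i + 1) := Nat.div_mul_le_self _ _

theorem coveredG_le (i : ℕ) : S.coveredG i ≤ S.G (i + 1) := by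
  rw [coveredG, S.G_succ, mul_assoc]
  exact Nat.mul_le_mul_left _ (Nat.div_mul_le_self _ _)

/-- The position in its block of length `G k`, for points that have such a block. -/
noncomputable def pos (x : Odometer n) (k : ℕ) : ℕ := residue x (S.A (k + 1)) % S.G k

theorem pos_lt (x : Odometer n) (k : ℕ) : S.pos x k < S.G k := Nat.mod_lt _ (S.G_pos k)

/-- This is where `A_dvd_G` is used: reducing modulo `G (k + 1)` loses nothing modulo `A (k + 1)`.
-/
theorem pos_succ_mod (x : Odometer n) (k : ℕ) :
    S.pos x (k + 1) % S.A (k + 1) = residue x (S.A (k + 1)) := by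
  rw [pos, Nat.mod_mod_of_dvd _ (S.A_dvd_G (k + 1)),
    residue_mod _ (S.cofinal_A.dvd_level _) (S.cofinal_A.dvd_succ (k + 1))]

/-- The multiple of `G k` is the start of the relocated block. The formula gives compatibility
modulo `G k`, and it shows that displacements within one block do not change at later stages. -/
theorem perm_pos_succ {x : Odometer n} {k : ℕ} (h : residue x (S.A (k + 1)) < S.coveredA k) :
    S.perm (k + 1) (S.pos x (k + 1)) = (S.pos x (k + 1) / S.A (k + 1) * (S.A (k + 1) / S.G k) +
      residue x (S.A (k + 1)) / S.G k) * S.G k + S.perm k (S.pos x k) := by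
  rw [perm, rearrange_of_lt (by rw [S.pos_succ_mod]; exact h), S.pos_succ_mod, pos, pos]

theorem invPerm_residue_succ {y : Odometer u} {k : ℕ}
    (h : residue y (S.G (k + 1)) < S.coveredG k) :
    S.invPerm (k + 1) (residue y (S.G (k + 1))) =
      residue y (S.G (k + 1)) / S.G k / (S.A (k + 1) / S.G k) * S.A (k + 1) +
        residue y (S.G (k + 1)) / S.G k % (S.A (k + 1) / S.G k) * S.G k +
          S.invPerm k (residue y (S.G k)) := by
  rw [invPerm, unrearrange_of_lt h,
    residue_mod _ (S.cofinal_G.dvd_level _) (S.cofinal_G.dvd_succ k)]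

/-- The rearrangement map. -/
noncomputable def toMap (x : Odometer n) : Odometer u :=
  S.cofinal_G.glue fun k => S.perm k (S.pos x k)

/-- The inverse of the rearrangement map. -/
noncomputable def invMap (y : Odometer u) : Odometer n :=
  S.cofinal_A.glue fun k => S.invPerm k (residue y (S.G k))

theorem measurable_toMap : Measurable S.toMap :=
  S.cofinal_G.measurable_glue.comp (measurable_pi_lambda _ fun k =>
    (measurable_from_nat (f := fun r => S.perm k (r % S.G k))).comp (measurable_residue _))

theorem measurable_invMap : Measurable S.invMap :=
  S.cofinal_A.measurable_glue.comp (measurable_pi_lambda _ fun k =>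
    (measurable_from_nat (f := S.invPerm k)).comp (measurable_residue _))

theorem residue_toMap {x : Odometer n} {K : ℕ}
    (h : ∀ i, K ≤ i → residue x (S.A (i + 1)) < S.coveredA i) {k : ℕ} (hk : K ≤ k) :
    residue (S.toMap x) (S.G k) = S.perm k (S.pos x k) := by
  rw [toMap, S.cofinal_G.residue_glue (K := K) (fun k hk => ?_) hk,
    Nat.mod_eq_of_lt (S.perm_lt k _ (S.pos_lt x k))]
  rw [S.perm_pos_succ (h k hk), Nat.ModEq, Nat.mul_add_mod_self_right]

theorem residue_invMap {y : Odometer u} {K : ℕ}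
    (h : ∀ i, K ≤ i → residue y (S.G (i + 1)) < S.coveredG i) {k : ℕ} (hk : K ≤ k) :
    residue (S.invMap y) (S.A k) = S.invPerm k (residue y (S.G k)) % S.A k := by
  rw [invMap, S.cofinal_A.residue_glue (K := K) (fun k hk => ?_) hk]
  rw [S.invPerm_residue_succ (h k hk)]
  have h1 := (S.cofinal_A.dvd_succ k).mul_left
    (residue y (S.G (k + 1)) / S.G k / (S.A (k + 1) / S.G k))
  have h2 := (S.A_dvd_G k).mul_left
    (residue y (S.G (k + 1)) / S.G k % (S.A (k + 1) / S.G k))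
  -- Undoing the rearrangement shifts by multiples of `A (k + 1)` and `G k`, both divisible by `A
  -- k`.
  exact ((Nat.modEq_zero_iff_dvd.2 (h1.add h2)).add_right _).trans (by rw [zero_add])

theorem invMap_toMap {x : Odometer n} {K : ℕ}
    (h : ∀ i, K ≤ i → residue x (S.A (i + 1)) < S.coveredA i) : S.invMap (S.toMap x) = x := by
  have hz (k : ℕ) (hk : K ≤ k) :
      S.invPerm k (residue (S.toMap x) (S.G k)) = S.pos x k := by
    rw [S.residue_toMap h hk, S.invPerm_perm k _ (S.pos_lt x k)]
  have hm (k : ℕ) : S.pos x k % S.A k = residue x (S.A k) := by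
    rw [pos, Nat.mod_mod_of_dvd _ (S.A_dvd_G k),
      residue_mod _ (S.cofinal_A.dvd_level _) (S.cofinal_A.dvd_succ k)]
  refine S.cofinal_A.ext K fun k hk => ?_
  rw [invMap, S.cofinal_A.residue_glue (K := K) (fun k hk => ?_) hk, hz k hk, hm]
  rw [hz k hk, hz _ (by omega), Nat.ModEq, hm, ← residue_mod x (S.cofinal_A.dvd_level _)
    (S.cofinal_A.dvd_succ k), ← hm (k + 1), Nat.mod_mod_of_dvd _ (S.cofinal_A.dvd_succ k)]

theorem toMap_invMap {y : Odometer u} {K : ℕ}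
    (h : ∀ i, K ≤ i → residue y (S.G (i + 1)) < S.coveredG i) : S.toMap (S.invMap y) = y := by
  have hz (k : ℕ) (hk : K ≤ k) :
      S.perm k (S.pos (S.invMap y) k) = residue y (S.G k) := by
    have hr := residue_lt y (S.cofinal_G.dvd_level k)
    have hi := S.invPerm_lt k _ hr
    have hm : 0 < S.A (k + 1) / S.G k := Nat.pos_of_ne_zero fun h0 => by
      have := h k hk
      simp [coveredG, h0] at this
    have hb := block_lt (Nat.mod_lt (residue y (S.G (k + 1)) / S.G k) hm) hi
    have hA := Nat.div_mul_le_self (S.A (k + 1)) (S.G k)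
    have : S.pos (S.invMap y) k = S.invPerm k (residue y (S.G k)) := by
      have e := S.invPerm_residue_succ (h k hk)
      rw [add_assoc] at e
      rw [pos, S.residue_invMap h (by omega), (div_mod_of_eq e (by omega)).2,
        Nat.mul_add_mod_self_right, Nat.mod_eq_of_lt hi]
    rw [this, S.perm_invPerm k _ hr]
  refine S.cofinal_G.ext K fun k hk => ?_
  rw [toMap, S.cofinal_G.residue_glue (K := K) (fun k hk => ?_) hk, hz k hk, Nat.mod_eq_of_lt
    (residue_lt y (S.cofinal_G.dvd_level k))]
  rw [hz k hk, hz _ (by omega), Nat.ModEq, residue_mod _ (S.cofinal_G.dvd_level _)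
    (S.cofinal_G.dvd_succ k), Nat.mod_eq_of_lt (residue_lt y (S.cofinal_G.dvd_level k))]

/-- The displacement is decided at stage `K + 1`: both points lie in the same interval of length `A
(K + 1)`. Their block starts differ by at most `|g| + G K`, and the positions inside the blocks
contribute less than `G K`. The weaker bound stated is the one that also holds for the inverse. -/
theorem exists_toMap_vadd {x : Odometer n} {g : ℤ} {K : ℕ}
    (h : ∀ i, K ≤ i → g.natAbs ≤ residue x (S.A (i + 1)) ∧
      residue x (S.A (i + 1)) + g.natAbs < S.coveredA i) :
    ∃ d : ℤ, |d| ≤ 2 * |g| + 3 * S.G K ∧ S.toMap (g +ᵥ x) = d +ᵥ S.toMap x := by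
  have hA := S.coveredA_le
  have hr (i : ℕ) (hi : K ≤ i) :
      (residue (g +ᵥ x) (S.A (i + 1)) : ℤ) = residue x (S.A (i + 1)) + g := by
    have := h i hi
    have := hA i
    exact residue_vadd_of_mem g x (S.cofinal_A.dvd_level _) (by omega) (by omega)
  have h1 (i : ℕ) (hi : K ≤ i) : residue x (S.A (i + 1)) < S.coveredA i := by
    have := h i hi
    omega
  have h2 (i : ℕ) (hi : K ≤ i) : residue (g +ᵥ x) (S.A (i + 1)) < S.coveredA i := by
    have := h i hi
    have := hr i hi
    omega
  have hmod (z : Odometer n) (i : ℕ) : residue z (S.A (i + 1 + 1)) % S.A (i + 1) =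
      residue z (S.A (i + 1)) := residue_mod z (S.cofinal_A.dvd_level _) (S.cofinal_A.dvd_succ _)
  have hq (k : ℕ) (hk : K ≤ k) : residue (g +ᵥ x) (S.A (k + 1 + 1)) / S.A (k + 1) =
      residue x (S.A (k + 1 + 1)) / S.A (k + 1) :=
    div_eq_div_of_mod_add (hmod x k) (hmod _ k) (hr (k + 1) (by omega)) (hr k hk)
  have hp (k : ℕ) (hk : K ≤ k) : S.pos (g +ᵥ x) (k + 1) / S.A (k + 1) =
      S.pos x (k + 1) / S.A (k + 1) := by
    rw [pos, pos, S.G_succ, mul_comm, Nat.mod_mul_right_div_self, Nat.mod_mul_right_div_self,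
      hq k hk]
  have hG (k : ℕ) (hk : K ≤ k) : residue (g +ᵥ x) (S.A (k + 1 + 1)) / S.G (k + 1) =
      residue x (S.A (k + 1 + 1)) / S.G (k + 1) := by
    rw [S.G_succ, mul_comm, ← Nat.div_div_eq_div_mul, ← Nat.div_div_eq_div_mul, hq k hk]
  set s : ℕ → ℕ := fun k => S.perm k (S.pos x k) with hs
  set s' : ℕ → ℕ := fun k => S.perm k (S.pos (g +ᵥ x) k) with hs'
  -- From stage `K + 1` on both points lie in a common block, whose relocation cancels in the
  -- difference.
  have hd (k : ℕ) (hk : K + 1 ≤ k) : (s' k : ℤ) = s k + (s' (K + 1) - s (K + 1)) := by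
    induction k, hk using Nat.le_induction with
    | base => ring
    | succ k hk ih =>
      obtain ⟨k, rfl⟩ : ∃ l, k = l + 1 := ⟨k - 1, by omega⟩
      have e := S.perm_pos_succ (h1 (k + 1) (by omega))
      have e' := S.perm_pos_succ (h2 (k + 1) (by omega))
      rw [hp (k + 1) (by omega), hG k (by omega)] at e'
      simp only [hs, hs'] at ih ⊢
      rw [e, e']
      push_cast at ih ⊢
      linarith
  refine ⟨s' (K + 1) - s (K + 1), ?_, S.cofinal_G.ext (K + 1) fun k hk => ?_⟩
  · have e := S.perm_pos_succ (h1 K le_rfl)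
    have e' := S.perm_pos_succ (h2 K le_rfl)
    rw [hp K le_rfl] at e'
    have l := S.perm_lt K _ (S.pos_lt x K)
    have l' := S.perm_lt K _ (S.pos_lt (g +ᵥ x) K)
    have hdiv := abs_div_sub_div_mul_le (hr K le_rfl) (S.G_pos K)
    rw [← Nat.abs_cast (S.G K), ← abs_mul, Nat.abs_cast] at hdiv
    simp only [hs, hs']
    rw [e, e']
    have hg := abs_nonneg g
    rw [abs_le] at hdiv ⊢
    push_cast at hdiv ⊢
    constructor <;> linarith
  · have e := residue_vadd (s' (K + 1) - s (K + 1)) (S.toMap x) (S.cofinal_G.dvd_level k)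
    rw [S.residue_toMap h1 (by omega)] at e
    rw [S.residue_toMap h2 (by omega)]
    have l' := S.perm_lt k _ (S.pos_lt (g +ᵥ x) k)
    have e2 := hd k hk
    simp only [hs, hs'] at e e2 ⊢
    rw [← e2, Int.emod_eq_of_lt (by omega) (by omega)] at e
    exact_mod_cast e.symm

/-- Same mechanism, but putting blocks back also reinserts the loose points of each interval of
length `A (K + 1)` that is passed; this accounts for the second `|g| + G K` in the bound. -/
theorem exists_invMap_vadd {y : Odometer u} {g : ℤ} {K : ℕ}
    (h : ∀ i, K ≤ i → g.natAbs ≤ residue y (S.G (i + 1)) ∧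
      residue y (S.G (i + 1)) + g.natAbs < S.coveredG i) :
    ∃ d : ℤ, |d| ≤ 2 * |g| + 3 * S.G K ∧ S.invMap (g +ᵥ y) = d +ᵥ S.invMap y := by
  have hA := S.coveredG_le
  have hr (i : ℕ) (hi : K ≤ i) :
      (residue (g +ᵥ y) (S.G (i + 1)) : ℤ) = residue y (S.G (i + 1)) + g := by
    have := h i hi
    have := hA i
    exact residue_vadd_of_mem g y (S.cofinal_G.dvd_level _) (by omega) (by omega)
  have h1 (i : ℕ) (hi : K ≤ i) : residue y (S.G (i + 1)) < S.coveredG i := by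
    have := h i hi
    omega
  have h2 (i : ℕ) (hi : K ≤ i) : residue (g +ᵥ y) (S.G (i + 1)) < S.coveredG i := by
    have := h i hi
    have := hr i hi
    omega
  have hmod (z : Odometer u) (i : ℕ) : residue z (S.G (i + 1 + 1)) % S.G (i + 1) =
      residue z (S.G (i + 1)) := residue_mod z (S.cofinal_G.dvd_level _) (S.cofinal_G.dvd_succ _)
  have hq (k : ℕ) (hk : K ≤ k) : residue (g +ᵥ y) (S.G (k + 1 + 1)) / S.G (k + 1) =
      residue y (S.G (k + 1 + 1)) / S.G (k + 1) :=
    div_eq_div_of_mod_add (hmod y k) (hmod _ k) (hr (k + 1) (by omega)) (hr k hk)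
  set t : ℕ → ℕ := fun k => S.invPerm k (residue y (S.G k)) with ht
  set t' : ℕ → ℕ := fun k => S.invPerm k (residue (g +ᵥ y) (S.G k)) with ht'
  have hd (k : ℕ) (hk : K + 1 ≤ k) : (t' k : ℤ) = t k + (t' (K + 1) - t (K + 1)) := by
    induction k, hk using Nat.le_induction with
    | base => ring
    | succ k hk ih =>
      obtain ⟨k, rfl⟩ : ∃ l, k = l + 1 := ⟨k - 1, by omega⟩
      have e := S.invPerm_residue_succ (h1 (k + 1) (by omega))
      have e' := S.invPerm_residue_succ (h2 (k + 1) (by omega))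
      rw [hq k (by omega)] at e'
      simp only [ht, ht'] at ih ⊢
      rw [e, e']
      push_cast at ih ⊢
      linarith
  refine ⟨t' (K + 1) - t (K + 1), ?_, S.cofinal_A.ext (K + 1) fun k hk => ?_⟩
  · have e := S.invPerm_residue_succ (h1 K le_rfl)
    have e' := S.invPerm_residue_succ (h2 K le_rfl)
    have l := S.invPerm_lt K _ (residue_lt y (S.cofinal_G.dvd_level K))
    have l' := S.invPerm_lt K _ (residue_lt (g +ᵥ y) (S.cofinal_G.dvd_level K))
    have hdiv := abs_div_sub_div_mul_le (hr K le_rfl) (S.G_pos K)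
    simp only [ht, ht']
    rw [e, e']
    generalize residue (g +ᵥ y) (S.G (K + 1)) / S.G K = c' at *
    generalize residue y (S.G (K + 1)) / S.G K = c at *
    have hR := Nat.mod_lt (S.A (K + 1)) (S.G_pos K)
    have eA := Nat.div_add_mod' (S.A (K + 1)) (S.G K)
    generalize S.A (K + 1) / S.G K = m at *
    generalize S.A (K + 1) % S.G K = R at *
    have ec := Nat.div_add_mod' c m
    have ec' := Nat.div_add_mod' c' m
    have hcm : |((c' / m : ℕ) : ℤ) - (c / m : ℕ)| ≤ |(c' : ℤ) - c| := by
      rcases Nat.eq_zero_or_pos m with rfl | hm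
      · simp
      rcases le_total c c' with hc | hc
      · have := Nat.div_le_div_right (c := m) hc
        rw [abs_of_nonneg (by omega), abs_of_nonneg (by omega)]
        have : c' / m ≤ c / m + (c' - c) := by
          rw [← Nat.add_mul_div_right _ _ hm]
          exact Nat.div_le_div_right (by nlinarith [Nat.sub_add_cancel hc])
        omega
      · have := Nat.div_le_div_right (c := m) hc
        rw [abs_of_nonpos (by omega), abs_of_nonpos (by omega)]
        have : c / m ≤ c' / m + (c - c') := by
          rw [← Nat.add_mul_div_right _ _ hm]
          exact Nat.div_le_div_right (by nlinarith [Nat.sub_add_cancel hc])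
        omega
    -- At most as many intervals as blocks are passed, and each contributes `R < G K` loose points.
    have hRG : |((c' / m : ℕ) : ℤ) - (c / m : ℕ)| * R ≤ |(c' : ℤ) - c| * S.G K :=
      mul_le_mul hcm (by exact_mod_cast hR.le) (by positivity) (abs_nonneg _)
    have key : ((c' / m * S.A (K + 1) + c' % m * S.G K +
          S.invPerm K (residue (g +ᵥ y) (S.G K)) : ℕ) : ℤ) -
        (c / m * S.A (K + 1) + c % m * S.G K + S.invPerm K (residue y (S.G K)) : ℕ) =
        ((c' : ℤ) - c) * S.G K + (((c' / m : ℕ) : ℤ) - (c / m : ℕ)) * R +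
          (S.invPerm K (residue (g +ᵥ y) (S.G K)) - S.invPerm K (residue y (S.G K))) := by
      conv_rhs => rw [← ec, ← ec']
      rw [← eA]
      -- The rewriting above also expanded `c` and `c'` inside the quotients; this undoes it there.
      have e1 : (c' / m * m + c' % m) / m = c' / m := by rw [ec']
      have e2 : (c / m * m + c % m) / m = c / m := by rw [ec]
      rw [e1, e2]
      push_cast
      ring
    rw [key]
    refine (abs_add_three _ _ _).trans ?_
    rw [abs_mul, abs_mul, Nat.abs_cast, Nat.abs_cast]
    have : |(S.invPerm K (residue (g +ᵥ y) (S.G K)) : ℤ) -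
        S.invPerm K (residue y (S.G K))| ≤ S.G K :=
      abs_le.2 ⟨by omega, by omega⟩
    linarith
  · have e := residue_vadd (t' (K + 1) - t (K + 1)) (S.invMap y) (S.cofinal_A.dvd_level k)
    rw [S.residue_invMap h1 (by omega)] at e
    rw [S.residue_invMap h2 (by omega)]
    have e2 := hd k hk
    simp only [ht, ht'] at e e2 ⊢
    push_cast at e
    rw [Int.emod_add_emod, ← e2] at e
    exact_mod_cast e.symm

end RearrangementScheme

/-! ### Finiteness of entropy -/

/-- Young's inequality for the entropy function, from `1 + t ≤ exp t` at `t = -c - log p`. It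
converts a moment bound into an entropy bound. -/
theorem negMulLog_le_mul_add_exp {p : ℝ} (hp : 0 ≤ p) (c : ℝ) :
    Real.negMulLog p ≤ p * c + Real.exp (-c) := by
  rcases hp.eq_or_lt with rfl | hp
  · simp [Real.exp_nonneg]
  have h := Real.add_one_le_exp (-c - Real.log p)
  rw [Real.exp_sub, Real.exp_log hp, le_div_iff₀ hp] at h
  rw [Real.negMulLog]
  nlinarith

theorem tsum_ofReal_exp_log_lt_top :
    ∑' s : ℤ, ENNReal.ofReal (Real.exp (-(2 * Real.log (1 + |(s : ℝ)|)))) < ∞ := by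
  have e (s : ℤ) : Real.exp (-(2 * Real.log (1 + |(s : ℝ)|))) = 1 / (1 + |(s : ℝ)|) ^ 2 := by
    have h : 0 < 1 + |(s : ℝ)| := by positivity
    rw [Real.exp_neg, mul_comm, Real.exp_mul, Real.exp_log h, one_div, Real.rpow_ofNat]
  simp_rw [e]
  rw [lt_top_iff_ne_top]
  refine Summable.tsum_ofReal_ne_top ?_
  have hN : Summable fun k : ℕ => 1 / (1 + (k : ℝ)) ^ 2 := by
    have := (summable_nat_add_iff 1).2 (Real.summable_one_div_nat_pow.2 one_lt_two)
    refine this.congr fun k => ?_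
    push_cast
    rw [add_comm]
  refine Summable.of_nat_of_neg ?_ ?_
  · simpa using hN
  · simpa using hN

/-- A countable family of disjoint sets indexed by integers has finite entropy if the index is
suitably bounded outside of small sets. -/
theorem shannonEntropy_lt_top {X : Type*} [MeasurableSpace X] (μ : Measure X)
    [IsProbabilityMeasure μ] (P : ℤ → Set X) (hP : ∀ s, MeasurableSet (P s))
    (hdisj : Pairwise (Function.onFun Disjoint P)) (F : ℕ → Set X) (hF : ∀ i, MeasurableSet (F i))
    (M : ℕ → ℝ) (hev : ∀ s, ∀ x ∈ P s, ∃ K, ∀ i, K ≤ i → x ∉ F i)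
    (hM : ∀ s, ∀ x ∈ P s, ∀ K, (∀ i, K ≤ i → x ∉ F i) → |(s : ℝ)| ≤ M K)
    (hsum : ∑' i, μ (F i) * ENNReal.ofReal (Real.log (1 + M (i + 1))) < ∞) :
    shannonEntropy μ P < ∞ := by
  set c : ℤ → ℝ≥0∞ := fun s => ENNReal.ofReal (Real.log (1 + |(s : ℝ)|)) with hc
  -- The logarithmic moment of the index, bounded pointwise. If the least valid threshold at `x` is
  -- `k + 1`, then `x ∈ F k`, and the `k`-th term on the right dominates; threshold `0` is covered
  -- by the constant.
  have hbound : ∑' s, μ (P s) * c s ≤ ENNReal.ofReal (Real.log (1 + M 0)) +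
      ∑' i, μ (F i) * ENNReal.ofReal (Real.log (1 + M (i + 1))) := by
    have h1 : ∑' s, μ (P s) * c s = ∫⁻ x, ∑' s, (P s).indicator (fun _ => c s) x ∂μ := by
      rw [lintegral_tsum fun s => (measurable_const.indicator (hP s)).aemeasurable]
      refine tsum_congr fun s => ?_
      rw [lintegral_indicator_const (hP s), mul_comm]
    have h2 : ENNReal.ofReal (Real.log (1 + M 0)) +
        ∑' i, μ (F i) * ENNReal.ofReal (Real.log (1 + M (i + 1))) =
        ∫⁻ x, (ENNReal.ofReal (Real.log (1 + M 0)) + ∑' i, (F i).indicator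
          (fun _ => ENNReal.ofReal (Real.log (1 + M (i + 1)))) x) ∂μ := by
      rw [lintegral_add_left measurable_const,
        lintegral_tsum fun i => (measurable_const.indicator (hF i)).aemeasurable]
      simp only [lintegral_const, measure_univ, mul_one]
      congr 1
      refine tsum_congr fun i => ?_
      rw [lintegral_indicator_const (hF i), mul_comm]
    rw [h1, h2]
    refine lintegral_mono fun x => ?_
    by_cases hx : ∃ s, x ∈ P s
    · obtain ⟨s, hs⟩ := hx
      have e : ∑' s, (P s).indicator (fun _ => c s) x = c s := by
        rw [tsum_eq_single s fun s' hs' => Set.indicator_of_notMem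
          (fun h => Set.disjoint_left.1 (hdisj hs') h hs) _, Set.indicator_of_mem hs]
      have hle (K : ℕ) (h : ∀ i, K ≤ i → x ∉ F i) : c s ≤ ENNReal.ofReal (Real.log (1 + M K)) :=
        ENNReal.ofReal_le_ofReal (Real.log_le_log (by positivity)
          (by linarith [hM s x hs K h]))
      simp only [e]
      classical
      have hK := hev s x hs
      rcases Nat.eq_zero_or_pos (Nat.find hK) with h0 | hpos
      · exact (hle 0 (h0 ▸ Nat.find_spec hK)).trans le_self_add
      · obtain ⟨k, hk⟩ : ∃ k, Nat.find hK = k + 1 := ⟨Nat.find hK - 1, by omega⟩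
        have hmem : x ∈ F k := by
          by_contra h
          refine Nat.find_min hK (m := k) (by omega) fun i hi => ?_
          rcases hi.eq_or_lt with rfl | hi
          · exact h
          · exact Nat.find_spec hK i (by omega)
        refine (hle (k + 1) (hk ▸ Nat.find_spec hK)).trans (le_add_left ?_)
        refine le_trans ?_ (ENNReal.le_tsum k)
        rw [Set.indicator_of_mem hmem]
    · have e : ∑' s, (P s).indicator (fun _ => c s) x = 0 :=
        ENNReal.tsum_eq_zero.2 fun s => Set.indicator_of_notMem (fun h => hx ⟨s, h⟩) _
      simp [e]
  -- The factor `2` makes the exponential equal to `(1 + |s|)⁻²`, which is summable over `ℤ`.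
  have hterm (s : ℤ) : ENNReal.ofReal (Real.negMulLog (μ.real (P s))) ≤
      2 * (μ (P s) * c s) + ENNReal.ofReal (Real.exp (-(2 * Real.log (1 + |(s : ℝ)|)))) := by
    refine (ENNReal.ofReal_le_ofReal (negMulLog_le_mul_add_exp measureReal_nonneg
      (2 * Real.log (1 + |(s : ℝ)|)))).trans ?_
    have hl : 0 ≤ Real.log (1 + |(s : ℝ)|) := Real.log_nonneg (by simp)
    rw [ENNReal.ofReal_add (by positivity) (Real.exp_nonneg _), ENNReal.ofReal_mul (by positivity),
      ENNReal.ofReal_mul (by norm_num), ofReal_measureReal]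
    refine add_le_add_left (le_of_eq ?_) _
    simp only [hc, ENNReal.ofReal_ofNat]
    ring
  refine (ENNReal.tsum_le_tsum hterm).trans_lt ?_
  rw [ENNReal.tsum_add, ENNReal.tsum_mul_left]
  refine ENNReal.add_lt_top.2 ⟨ENNReal.mul_lt_top (by simp) (hbound.trans_lt ?_),
    tsum_ofReal_exp_log_lt_top⟩
  exact ENNReal.add_lt_top.2 ⟨ENNReal.ofReal_lt_top, hsum⟩

/-! ### Windows in odometers -/

namespace Odometer

variable {n : ℕ → ℕ+}

/-- The points whose residue modulo `L` is at distance less than `N` from the complement of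
`{0, …, Q - 1}`. -/
def margin (n : ℕ → ℕ+) (L Q N : ℕ) : Set (Odometer n) :=
  {x | ¬ (N ≤ residue x L ∧ residue x L + N < Q)}

theorem measurableSet_margin (L Q N : ℕ) : MeasurableSet (margin n L Q N) :=
  measurable_residue L (MeasurableSet.of_discrete (s := {r | ¬ (N ≤ r ∧ r + N < Q)}))

theorem haar_margin_le {L Q N : ℕ} (h : ∃ j, L ∣ partialProduct n j) :
    haar n (margin n L Q N) ≤ (L - Q + 2 * N : ℕ) / (L : ℝ≥0∞) := by
  classical
  let s := (Finset.range L).filter fun r => ¬ (N ≤ r ∧ r + N < Q)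
  have e : margin n L Q N = {x | residue x L ∈ s} := by
    ext x
    simp [margin, s, residue_lt x h]
  rw [e]
  refine (haar_residue_mem_le h s fun a ha => by
    simp only [s, Finset.mem_filter, Finset.mem_range] at ha; exact ha.1).trans ?_
  gcongr
  -- Bad residues are near the left end, near the right end, or beyond the window.
  have hs : s ⊆ Finset.range N ∪ Finset.Ico (Q - N) Q ∪ Finset.Ico Q L := by
    intro r hr
    simp only [s, Finset.mem_filter, Finset.mem_range, Finset.mem_union, Finset.mem_Ico] at hr ⊢
    omega
  refine (Finset.card_le_card hs).trans ((Finset.card_union_le _ _).trans ?_)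
  have := Finset.card_union_le (Finset.range N) (Finset.Ico (Q - N) Q)
  simp only [Finset.card_range, Nat.card_Ico] at this ⊢
  omega

/-- The points that eventually stay far from the complements of the windows
`{0, …, Q i - 1}` modulo `L i`. -/
def core (n : ℕ → ℕ+) (L Q : ℕ → ℕ) : Set (Odometer n) :=
  {x | ∀ N, ∃ K, ∀ i, K ≤ i → x ∉ margin n (L i) (Q i) N}

variable {L Q : ℕ → ℕ}

theorem measurableSet_core : MeasurableSet (core n L Q) := by
  have : core n L Q = ⋂ N, ⋃ K, ⋂ i, ⋂ (_ : K ≤ i), (margin n (L i) (Q i) N)ᶜ := by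
    ext x
    simp [core]
  rw [this]
  exact MeasurableSet.iInter fun N => MeasurableSet.iUnion fun K => MeasurableSet.iInter fun i =>
    MeasurableSet.iInter fun _ => (measurableSet_margin _ _ _).compl

/-- Borel–Cantelli for each of the countably many `N`. -/
theorem haar_core_compl (h : ∀ N, ∑' i, haar n (margin n (L i) (Q i) N) ≠ ∞) :
    haar n (core n L Q)ᶜ = 0 := by
  have : (core n L Q)ᶜ = ⋃ N, {x | ∃ᶠ i in Filter.atTop, x ∈ margin n (L i) (Q i) N} := by
    ext x
    simp [core, Filter.frequently_atTop]
  rw [this, measure_iUnion_null_iff]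
  exact fun N => measure_setOfPred_frequently_eq_zero (h N)

/-- Translation by `g` costs at most `|g|` of margin, and the core allows every margin. -/
theorem vadd_mem_core (hL : ∀ i, ∃ j, L i ∣ partialProduct n j) (hQ : ∀ i, Q i ≤ L i) (g : ℤ)
    {x : Odometer n} (hx : x ∈ core n L Q) : g +ᵥ x ∈ core n L Q := by
  intro N
  obtain ⟨K, hK⟩ := hx (N + g.natAbs)
  refine ⟨K, fun i hi => ?_⟩
  have h := hK i hi
  have hq := hQ i
  simp only [margin, Set.mem_ofPred_eq, not_not] at h ⊢
  have := residue_vadd_of_mem g x (hL i) (by omega) (by omega)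
  omega

theorem exists_of_mem_core {x : Odometer n} (hx : x ∈ core n L Q) (N : ℕ) :
    ∃ K, ∀ i, K ≤ i → N ≤ residue x (L i) ∧ residue x (L i) + N < Q i := by
  obtain ⟨K, hK⟩ := hx N
  exact ⟨K, fun i hi => not_not.1 (hK i hi)⟩

end Odometer

namespace Odometer

theorem vadd_right_injective {n : ℕ → ℕ+} (h : ∀ B : ℕ, ∃ j, B < partialProduct n j) {s d : ℤ}
    {x : Odometer n} (e : s +ᵥ x = d +ᵥ x) : s = d := by
  have : (-d + s) +ᵥ x = x := by rw [add_vadd, e, neg_vadd_vadd]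
  have := eq_zero_of_vadd_eq h this
  omega

end Odometer

/-! ### The rearrangement map as an orbit equivalence. -/

namespace RearrangementScheme

open Odometer

variable {n u : ℕ → ℕ+} (S : RearrangementScheme n u)

/-- The domain of good points of the rearrangement map. -/
def coreA : Set (Odometer n) := core n (fun i => S.A (i + 1)) S.coveredA

/-- The domain of good points of the inverse of the rearrangement map. -/
def coreG : Set (Odometer u) := core u (fun i => S.G (i + 1)) S.coveredG

theorem measurableSet_coreA : MeasurableSet S.coreA := measurableSet_core

theorem measurableSet_coreG : MeasurableSet S.coreG := measurableSet_core

theorem invMap_toMap_of_mem {x : Odometer n} (hx : x ∈ S.coreA) : S.invMap (S.toMap x) = x := by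
  obtain ⟨K, hK⟩ := exists_of_mem_core hx 0
  exact S.invMap_toMap fun i hi => (hK i hi).2

theorem toMap_invMap_of_mem {y : Odometer u} (hy : y ∈ S.coreG) : S.toMap (S.invMap y) = y := by
  obtain ⟨K, hK⟩ := exists_of_mem_core hy 0
  exact S.toMap_invMap fun i hi => (hK i hi).2

theorem exists_toMap_vadd_of_mem {x : Odometer n} (hx : x ∈ S.coreA) (g : ℤ) :
    ∃ d : ℤ, S.toMap (g +ᵥ x) = d +ᵥ S.toMap x := by
  obtain ⟨K, hK⟩ := exists_of_mem_core hx g.natAbs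
  obtain ⟨d, -, hd⟩ := S.exists_toMap_vadd hK
  exact ⟨d, hd⟩

theorem exists_invMap_vadd_of_mem {y : Odometer u} (hy : y ∈ S.coreG) (g : ℤ) :
    ∃ d : ℤ, S.invMap (g +ᵥ y) = d +ᵥ S.invMap y := by
  obtain ⟨K, hK⟩ := exists_of_mem_core hy g.natAbs
  obtain ⟨d, -, hd⟩ := S.exists_invMap_vadd hK
  exact ⟨d, hd⟩

theorem vadd_mem_coreA (g : ℤ) {x : Odometer n} (hx : x ∈ S.coreA) : g +ᵥ x ∈ S.coreA :=
  vadd_mem_core (fun _ => S.cofinal_A.dvd_level _) S.coveredA_le g hx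

theorem vadd_mem_coreG (g : ℤ) {y : Odometer u} (hy : y ∈ S.coreG) : g +ᵥ y ∈ S.coreG :=
  vadd_mem_core (fun _ => S.cofinal_G.dvd_level _) S.coveredG_le g hy

/-- A covered position is determined by its block and its permuted place there; prescribing that
place modulo `G k` leaves `G l / G k` choices per block. -/
theorem card_filter_perm_mul_le {k l b : ℕ} (hkl : k ≤ l) :
    ((Finset.range (S.coveredA l)).filter
      fun r => S.perm l (r % S.G l) % S.G k = b).card * S.G k ≤ S.A (l + 1) := by
  have hd := S.cofinal_G.dvd hkl
  have hle : ((Finset.range (S.coveredA l)).filter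
      fun r => S.perm l (r % S.G l) % S.G k = b).card ≤
      (Finset.range (S.A (l + 1) / S.G l) ×ˢ Finset.range (S.G l / S.G k)).card := by
    refine Finset.card_le_card_of_injOn
      (fun r => (r / S.G l, S.perm l (r % S.G l) / S.G k)) ?_ ?_
    · intro r hr
      simp only [Finset.coe_filter, Finset.mem_range, Set.mem_ofPred_eq] at hr
      simp only [Finset.coe_product, Finset.coe_range, Set.mem_prod, Set.mem_Iio]
      refine ⟨(Nat.div_lt_iff_lt_mul (S.G_pos l)).2 hr.1,
        (Nat.div_lt_iff_lt_mul (S.G_pos k)).2 ?_⟩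
      rw [Nat.div_mul_cancel hd]
      exact S.perm_lt l _ (Nat.mod_lt _ (S.G_pos l))
    · intro r hr r' hr' e
      simp only [Finset.coe_filter, Finset.mem_range, Set.mem_ofPred_eq] at hr hr'
      simp only [Prod.mk.injEq] at e
      have h1 : S.perm l (r % S.G l) = S.perm l (r' % S.G l) := by
        rw [← Nat.div_add_mod (S.perm l (r % S.G l)) (S.G k), e.2, hr.2, ← hr'.2,
          Nat.div_add_mod]
      have h2 : r % S.G l = r' % S.G l := by
        rw [← S.invPerm_perm l _ (Nat.mod_lt r (S.G_pos l)), h1,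
          S.invPerm_perm l _ (Nat.mod_lt r' (S.G_pos l))]
      rw [← Nat.div_add_mod r (S.G l), e.1, h2, Nat.div_add_mod]
  rw [Finset.card_product, Finset.card_range, Finset.card_range] at hle
  calc _ ≤ S.A (l + 1) / S.G l * (S.G l / S.G k) * S.G k := Nat.mul_le_mul_right _ hle
    _ = S.coveredA l := by rw [mul_assoc, Nat.div_mul_cancel hd, coveredA]
    _ ≤ _ := S.coveredA_le l

/-- Up to a null set, a point mapped into a cylinder of level `G k` lies in `E l` for all large `l`,
and counting gives each such `E l` mass at most `1 / G k`. By `eq_haar` upper bounds suffice. -/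
theorem map_toMap (h : haar n S.coreAᶜ = 0) : (haar n).map S.toMap = haar u := by
  have : IsProbabilityMeasure ((haar n).map S.toMap) :=
    Measure.isProbabilityMeasure_map S.measurable_toMap.aemeasurable
  refine S.cofinal_G.eq_haar _ fun k b _ => ?_
  rw [Measure.map_apply S.measurable_toMap
    (measurableSet_residue_eq _ _)]
  let E (l : ℕ) : Set (Odometer n) := {x | residue x (S.A (l + 1)) ∈
    (Finset.range (S.coveredA l)).filter fun r => S.perm l (r % S.G l) % S.G k = b}
  have hE (l : ℕ) (hl : k ≤ l) : haar n (E l) ≤ (S.G k : ℝ≥0∞)⁻¹ := by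
    refine (haar_residue_mem_le (S.cofinal_A.dvd_level _) _ fun a ha => ?_).trans ?_
    · simp only [Finset.mem_filter, Finset.mem_range] at ha
      exact ha.1.trans_le (S.coveredA_le l)
    · refine ENNReal.div_le_of_le_mul ?_
      rw [mul_comm, ← div_eq_mul_inv, ENNReal.le_div_iff_mul_le
        (Or.inl (by exact_mod_cast (S.G_pos k).ne')) (Or.inl (by simp))]
      exact_mod_cast S.card_filter_perm_mul_le hl
  have hsub : S.toMap ⁻¹' {y | residue y (S.G k) = b} ⊆
      (⋃ K, ⋂ l, ⋂ (_ : K ≤ l), E l) ∪ S.coreAᶜ := by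
    intro x hx
    by_cases hc : x ∈ S.coreA
    · left
      obtain ⟨K, hK⟩ := exists_of_mem_core hc 0
      simp only [Set.mem_iUnion, Set.mem_iInter]
      refine ⟨max K k, fun l hl => ?_⟩
      have hKl : K ≤ l := (le_max_left _ _).trans hl
      have hkl : k ≤ l := (le_max_right _ _).trans hl
      have e := S.residue_toMap (fun i hi => (hK i hi).2) hKl
      rw [pos] at e
      have e2 := residue_mod (S.toMap x) (S.cofinal_G.dvd_level l) (S.cofinal_G.dvd hkl)
      simp only [Set.mem_preimage, Set.mem_ofPred_eq] at hx
      simp only [E, Finset.mem_filter, Finset.mem_range, Set.mem_ofPred_eq]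
      exact ⟨(hK l hKl).2, by rw [← e, e2, hx]⟩
    · exact Or.inr hc
  refine (measure_mono hsub).trans ((measure_union_le _ _).trans ?_)
  rw [h, add_zero, Monotone.measure_iUnion]
  · refine iSup_le fun K => ?_
    refine (measure_mono ?_).trans (hE (max K k) (le_max_right _ _))
    exact Set.iInter₂_subset (max K k) (le_max_left _ _)
  · intro K K' hK
    exact Set.biInter_mono (fun l (hl : K' ≤ l) => hK.trans hl) fun _ _ => le_rfl

/-- The conull invariant set on which the rearrangement map is an orbit equivalence. -/
def domain : Set (Odometer n) := S.coreA ∩ S.toMap ⁻¹' S.coreG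

/-- The image of `S.domain` under the rearrangement map. -/
def codomain : Set (Odometer u) := S.coreG ∩ S.invMap ⁻¹' S.coreA

theorem measurableSet_domain : MeasurableSet S.domain :=
  S.measurableSet_coreA.inter (S.measurable_toMap S.measurableSet_coreG)

theorem measurableSet_codomain : MeasurableSet S.codomain :=
  S.measurableSet_coreG.inter (S.measurable_invMap S.measurableSet_coreA)

theorem toMap_mem_codomain {x : Odometer n} (hx : x ∈ S.domain) : S.toMap x ∈ S.codomain := by
  refine ⟨hx.2, ?_⟩
  rw [Set.mem_preimage, S.invMap_toMap_of_mem hx.1]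
  exact hx.1

theorem invMap_mem_domain {y : Odometer u} (hy : y ∈ S.codomain) : S.invMap y ∈ S.domain := by
  refine ⟨hy.2, ?_⟩
  rw [Set.mem_preimage, S.toMap_invMap_of_mem hy.1]
  exact hy.1

theorem vadd_mem_domain (g : ℤ) {x : Odometer n} (hx : x ∈ S.domain) : g +ᵥ x ∈ S.domain := by
  refine ⟨S.vadd_mem_coreA g hx.1, ?_⟩
  obtain ⟨d, hd⟩ := S.exists_toMap_vadd_of_mem hx.1 g
  rw [Set.mem_preimage, hd]
  exact S.vadd_mem_coreG d hx.2

theorem vadd_mem_codomain (g : ℤ) {y : Odometer u} (hy : y ∈ S.codomain) :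
    g +ᵥ y ∈ S.codomain := by
  refine ⟨S.vadd_mem_coreG g hy.1, ?_⟩
  obtain ⟨d, hd⟩ := S.exists_invMap_vadd_of_mem hy.1 g
  rw [Set.mem_preimage, hd]
  exact S.vadd_mem_coreA d hy.2

theorem haar_domain_compl (hA : haar n S.coreAᶜ = 0) (hG : haar u S.coreGᶜ = 0) :
    haar n S.domainᶜ = 0 := by
  rw [domain, Set.compl_inter, ← Set.preimage_compl]
  refine measure_union_null hA ?_
  rw [← Measure.map_apply S.measurable_toMap S.measurableSet_coreG.compl, S.map_toMap hA, hG]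

theorem haar_codomain_compl (hA : haar n S.coreAᶜ = 0) (hG : haar u S.coreGᶜ = 0) :
    haar u S.codomainᶜ = 0 := by
  rw [← S.map_toMap hA, Measure.map_apply S.measurable_toMap S.measurableSet_codomain.compl]
  exact measure_mono_null (fun x hx hx' => hx (S.toMap_mem_codomain hx'))
    (S.haar_domain_compl hA hG)

/-- The rearrangement map as an isomorphism of measurable spaces. -/
noncomputable def domainEquiv : S.domain ≃ᵐ S.codomain where
  toFun x := ⟨S.toMap x, S.toMap_mem_codomain x.2⟩
  invFun y := ⟨S.invMap y, S.invMap_mem_domain y.2⟩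
  left_inv x := Subtype.ext (S.invMap_toMap_of_mem x.2.1)
  right_inv y := Subtype.ext (S.toMap_invMap_of_mem y.2.1)
  measurable_toFun := (S.measurable_toMap.comp measurable_subtype_coe).subtype_mk
  measurable_invFun := (S.measurable_invMap.comp measurable_subtype_coe).subtype_mk

theorem measurePreserving_domainEquiv (hA : haar n S.coreAᶜ = 0) (hG : haar u S.coreGᶜ = 0) :
    MeasurePreserving S.domainEquiv ((haar n).comap (Subtype.val : S.domain → Odometer n))
      ((haar u).comap (Subtype.val : S.codomain → Odometer u)) := by
  refine ⟨S.domainEquiv.measurable, Measure.ext fun B hB => ?_⟩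
  rw [Measure.map_apply S.domainEquiv.measurable hB,
    (MeasurableEmbedding.subtype_coe S.measurableSet_domain).comap_apply,
    (MeasurableEmbedding.subtype_coe S.measurableSet_codomain).comap_apply, ← S.map_toMap hA,
    Measure.map_apply S.measurable_toMap
      ((MeasurableEmbedding.subtype_coe S.measurableSet_codomain).measurableSet_image.2 hB)]
  have e : (Subtype.val '' (S.domainEquiv ⁻¹' B) : Set (Odometer n)) =
      S.toMap ⁻¹' (Subtype.val '' B) ∩ S.domain := by
    ext x
    constructor
    · rintro ⟨z, hz, rfl⟩
      exact ⟨⟨_, hz, rfl⟩, z.2⟩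
    · rintro ⟨⟨y, hy, e⟩, hx⟩
      have : y = S.domainEquiv ⟨x, hx⟩ := Subtype.ext e
      rw [this] at hy
      exact ⟨⟨x, hx⟩, hy, rfl⟩
  rw [e]
  exact measure_inter_conull (S.haar_domain_compl hA hG)

theorem image_orbit_domainEquiv (x : S.domain) :
    {y : Odometer u | ∃ z : S.domain, (z : Odometer n) ∈ AddAction.orbit ℤ (x : Odometer n) ∧
      (S.domainEquiv z : Odometer u) = y} =
      AddAction.orbit ℤ (S.domainEquiv x : Odometer u) := by
  ext y
  constructor
  · rintro ⟨z, ⟨g, hg⟩, rfl⟩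
    obtain ⟨d, hd⟩ := S.exists_toMap_vadd_of_mem x.2.1 g
    refine ⟨d, ?_⟩
    change d +ᵥ S.toMap x = S.toMap z
    rw [← hd]
    exact congrArg S.toMap hg
  · rintro ⟨s, rfl⟩
    obtain ⟨d, hd⟩ := S.exists_invMap_vadd_of_mem x.2.2 s
    rw [S.invMap_toMap_of_mem x.2.1] at hd
    refine ⟨⟨d +ᵥ (x : Odometer n), S.vadd_mem_domain d x.2⟩, ⟨d, rfl⟩, ?_⟩
    change S.toMap (d +ᵥ (x : Odometer n)) = s +ᵥ S.toMap x
    rw [← hd]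
    exact S.toMap_invMap_of_mem (S.vadd_mem_coreG s x.2.2)

/-- The rearrangement map is an orbit equivalence. -/
noncomputable def orbitEquivalence (hA : haar n S.coreAᶜ = 0) (hG : haar u S.coreGᶜ = 0) :
    OrbitEquivalence ℤ ℤ (haar n) (haar u) where
  source := S.domain
  target := S.codomain
  measurableSet_source := S.measurableSet_domain
  measurableSet_target := S.measurableSet_codomain
  source_conull := S.haar_domain_compl hA hG
  target_conull := S.haar_codomain_compl hA hG
  source_invariant g _ hx := S.vadd_mem_domain g hx
  target_invariant g _ hy := S.vadd_mem_codomain g hy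
  toEquiv := S.domainEquiv
  measurePreserving := S.measurePreserving_domainEquiv hA hG
  map_orbit := S.image_orbit_domainEquiv

theorem mem_sourceCell (hA : haar n S.coreAᶜ = 0) (hG : haar u S.coreGᶜ = 0)
    {g s : ℤ} {x : Odometer n} :
    x ∈ (S.orbitEquivalence hA hG).sourceCell g s ↔
      x ∈ S.domain ∧ s +ᵥ S.toMap x = S.toMap (g +ᵥ x) :=
by
  constructor
  · rintro ⟨hx, e⟩
    exact ⟨hx, e⟩
  · rintro ⟨hx, e⟩
    exact ⟨hx, e⟩

theorem mem_targetCell (hA : haar n S.coreAᶜ = 0) (hG : haar u S.coreGᶜ = 0)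
    {s g : ℤ} {y : Odometer u} :
    y ∈ (S.orbitEquivalence hA hG).targetCell s g ↔
      y ∈ S.codomain ∧ g +ᵥ S.invMap y = S.invMap (s +ᵥ y) := by
  constructor
  · rintro ⟨hy, e⟩
    exact ⟨hy, e⟩
  · rintro ⟨hy, e⟩
    exact ⟨hy, e⟩

/-! ### Margin estimates and finite entropy of the cocycles. -/

theorem measurable_vadd {n : ℕ → ℕ+} (g : ℤ) : Measurable fun x : Odometer n => g +ᵥ x :=
  (measurePreserving_vadd g).measurable

/-- The summability condition ensuring that the cocycles have finite entropy. -/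
def IsFast : Prop :=
  ∑' i, (S.G i : ℝ≥0∞) / S.A (i + 1) * ENNReal.ofReal (1 + Real.log (S.G (i + 1))) ≠ ∞

theorem haar_margin_coveredA_le (i N : ℕ) :
    haar n (margin n (S.A (i + 1)) (S.coveredA i) N) ≤
      (1 + 2 * N : ℕ) * ((S.G i : ℝ≥0∞) / S.A (i + 1)) := by
  refine (haar_margin_le (S.cofinal_A.dvd_level _)).trans ?_
  rw [← mul_div_assoc]
  refine ENNReal.div_le_div_right ?_ _
  have h1 := Nat.div_add_mod' (S.A (i + 1)) (S.G i)
  have h2 := Nat.mod_lt (S.A (i + 1)) (S.G_pos i)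
  have h3 := S.G_pos i
  have : S.A (i + 1) - S.coveredA i + 2 * N ≤ (1 + 2 * N) * S.G i := by
    rw [coveredA]
    have : 2 * N * 1 ≤ 2 * N * S.G i := Nat.mul_le_mul_left _ h3
    rw [add_mul]
    omega
  exact_mod_cast this

/-- Passing from `A (i + 1)` to `G (i + 1)` multiplies both the length and the number of loose
points by `f i`, so the bound on the source side persists. -/
theorem haar_margin_coveredG_le (i N : ℕ) :
    haar u (margin u (S.G (i + 1)) (S.coveredG i) N) ≤
      (1 + 2 * N : ℕ) * ((S.G i : ℝ≥0∞) / S.A (i + 1)) := by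
  refine (haar_margin_le (S.cofinal_G.dvd_level _)).trans ?_
  have hf : 0 < S.f i := Nat.pos_of_ne_zero fun h => by
    have := S.G_pos (i + 1)
    rw [S.G_succ, h, zero_mul] at this
    omega
  have h1 := Nat.div_add_mod' (S.A (i + 1)) (S.G i)
  have h2 := Nat.mod_lt (S.A (i + 1)) (S.G_pos i)
  have h3 := S.G_pos i
  have : S.G (i + 1) - S.coveredG i + 2 * N ≤ S.f i * ((1 + 2 * N) * S.G i) := by
    have e : S.G (i + 1) - S.coveredG i = S.f i * (S.A (i + 1) % S.G i) := by
      rw [S.G_succ, coveredG, mul_assoc, ← Nat.mul_sub]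
      congr 1
      omega
    rw [e]
    calc _ ≤ S.f i * S.G i + S.f i * (2 * N * S.G i) := by
          refine Nat.add_le_add (Nat.mul_le_mul_left _ h2.le) ?_
          calc 2 * N = 1 * (2 * N * 1) := by ring
            _ ≤ _ := Nat.mul_le_mul hf (Nat.mul_le_mul_left _ h3)
      _ = _ := by ring
  rw [← mul_div_assoc, S.G_succ]
  have hf0 : (S.f i : ℝ≥0∞) ≠ 0 := by exact_mod_cast hf.ne'
  rw [S.G_succ] at this
  calc ((S.f i * S.A (i + 1) - S.coveredG i + 2 * N : ℕ) : ℝ≥0∞) / (S.f i * S.A (i + 1) : ℕ)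
      ≤ (S.f i * ((1 + 2 * N) * S.G i) : ℕ) / (S.f i * S.A (i + 1) : ℕ) :=
        ENNReal.div_le_div_right (by exact_mod_cast this) _
    _ = _ := by
        push_cast
        rw [ENNReal.mul_div_mul_left _ _ hf0 (by simp)]

variable {S}

theorem IsFast.tsum_ne_top (hS : S.IsFast) {m : ℕ → ℝ≥0∞} {N : ℕ}
    (hm : ∀ i, m i ≤ (1 + 2 * N : ℕ) * ((S.G i : ℝ≥0∞) / S.A (i + 1))) : ∑' i, m i ≠ ∞ := by
  have hle : ∑' i, m i ≤ (1 + 2 * N : ℕ) * ∑' i, (S.G i : ℝ≥0∞) / S.A (i + 1) *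
      ENNReal.ofReal (1 + Real.log (S.G (i + 1))) := by
    rw [← ENNReal.tsum_mul_left]
    refine ENNReal.tsum_le_tsum fun i => (hm i).trans ?_
    gcongr
    refine le_mul_of_one_le_right' ?_
    rw [ENNReal.one_le_ofReal]
    have := Real.log_natCast_nonneg (S.G (i + 1))
    linarith
  exact ne_top_of_le_ne_top (ENNReal.mul_ne_top (ENNReal.natCast_ne_top _) hS) hle

theorem IsFast.tsum_mul_log_lt_top (hS : S.IsFast) {m : ℕ → ℝ≥0∞} {N : ℕ}
    (hm : ∀ i, m i ≤ (1 + 2 * N : ℕ) * ((S.G i : ℝ≥0∞) / S.A (i + 1))) :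
    ∑' i, m i * ENNReal.ofReal (Real.log (1 + (2 * N + 3 * S.G (i + 1)))) < ∞ := by
  have hle : ∑' i, m i * ENNReal.ofReal (Real.log (1 + (2 * N + 3 * S.G (i + 1)))) ≤
      (1 + 2 * N : ℕ) * ENNReal.ofReal (1 + Real.log (4 + 2 * N)) *
        ∑' i, (S.G i : ℝ≥0∞) / S.A (i + 1) * ENNReal.ofReal (1 + Real.log (S.G (i + 1))) := by
    rw [← ENNReal.tsum_mul_left]
    refine ENNReal.tsum_le_tsum fun i => (mul_le_mul' (hm i) (?_ : _ ≤
      ENNReal.ofReal (1 + Real.log (4 + 2 * N)) *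
        ENNReal.ofReal (1 + Real.log (S.G (i + 1))))).trans_eq (by ring)
    have hG : (1 : ℝ) ≤ S.G (i + 1) := by exact_mod_cast S.G_pos (i + 1)
    have hN : (0 : ℝ) ≤ N := Nat.cast_nonneg N
    have h1 : 0 ≤ Real.log (4 + 2 * N) := Real.log_nonneg (by linarith)
    have h2 : 0 ≤ Real.log (S.G (i + 1)) := Real.log_nonneg hG
    rw [← ENNReal.ofReal_mul (by linarith)]
    refine ENNReal.ofReal_le_ofReal ?_
    -- Since `1 ≤ G (i + 1)`, the terms `1 + 2 * N` may be multiplied by it.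
    calc Real.log (1 + (2 * N + 3 * S.G (i + 1))) ≤ Real.log ((4 + 2 * N) * S.G (i + 1)) :=
          Real.log_le_log (by positivity) (by nlinarith)
      _ = Real.log (4 + 2 * N) + Real.log (S.G (i + 1)) :=
          Real.log_mul (by positivity) (by positivity)
      _ ≤ _ := by nlinarith
  exact hle.trans_lt (ENNReal.mul_lt_top (ENNReal.mul_lt_top (ENNReal.natCast_lt_top _)
    ENNReal.ofReal_lt_top) hS.lt_top)

theorem IsFast.shannonOrbitEquivalent (hS : S.IsFast)
    (hn : ∀ B : ℕ, ∃ j, B < partialProduct n j) (hu : ∀ B : ℕ, ∃ j, B < partialProduct u j) :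
    ShannonOrbitEquivalent ℤ ℤ (haar n) (haar u) := by
  have hA : haar n S.coreAᶜ = 0 :=
    haar_core_compl fun N => hS.tsum_ne_top fun i => S.haar_margin_coveredA_le i N
  have hG : haar u S.coreGᶜ = 0 :=
    haar_core_compl fun N => hS.tsum_ne_top fun i => S.haar_margin_coveredG_le i N
  have hcast {d g : ℤ} {K : ℕ} (h : |d| ≤ 2 * |g| + 3 * S.G K) :
      |(d : ℝ)| ≤ 2 * (g.natAbs : ℕ) + 3 * S.G K := by
    rw [← Int.natCast_natAbs g] at h
    have h' : ((|d| : ℤ) : ℝ) ≤ ((2 * (g.natAbs : ℕ) + 3 * S.G K : ℤ) : ℝ) := Int.cast_le.2 h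
    push_cast at h'
    simpa using h'
  refine ⟨isFreePMPAction hn, isFreePMPAction hu, S.orbitEquivalence hA hG, fun g => ?_,
    fun g => ?_⟩
  · refine shannonEntropy_lt_top (haar n) _ (fun s => ?_) (fun s s' hs => ?_)
      (fun i => margin n (S.A (i + 1)) (S.coveredA i) g.natAbs)
      (fun i => measurableSet_margin _ _ _) (fun i => 2 * g.natAbs + 3 * S.G i)
      (fun s x hx => ((S.mem_sourceCell hA hG).1 hx).1.1 _) (fun s x hx K hK => ?_)
      (hS.tsum_mul_log_lt_top fun i => S.haar_margin_coveredA_le i _)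
    · have e : (S.orbitEquivalence hA hG).sourceCell g s = S.domain ∩
          {x | s +ᵥ S.toMap x = S.toMap (g +ᵥ x)} := Set.ext fun x => S.mem_sourceCell hA hG
      rw [e]
      exact S.measurableSet_domain.inter
        (measurableSet_eq_fun ((measurable_vadd s).comp S.measurable_toMap)
          (S.measurable_toMap.comp (measurable_vadd g)))
    · refine Set.disjoint_left.2 fun x hx hx' => hs ?_
      rw [S.mem_sourceCell] at hx hx'
      exact vadd_right_injective hu (hx.2.trans hx'.2.symm)
    · rw [S.mem_sourceCell] at hx
      obtain ⟨d, hd, e⟩ := S.exists_toMap_vadd (x := x) (g := g) (K := K)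
        fun i hi => not_not.1 (hK i hi)
      rw [vadd_right_injective hu (hx.2.trans e)]
      exact hcast hd
  · refine shannonEntropy_lt_top (haar u) _ (fun s => ?_) (fun s s' hs => ?_)
      (fun i => margin u (S.G (i + 1)) (S.coveredG i) g.natAbs)
      (fun i => measurableSet_margin _ _ _) (fun i => 2 * g.natAbs + 3 * S.G i)
      (fun s y hy => ((S.mem_targetCell hA hG).1 hy).1.1 _) (fun s y hy K hK => ?_)
      (hS.tsum_mul_log_lt_top fun i => S.haar_margin_coveredG_le i _)
    · have e : (S.orbitEquivalence hA hG).targetCell g s = S.codomain ∩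
          {y | s +ᵥ S.invMap y = S.invMap (g +ᵥ y)} := Set.ext fun y => S.mem_targetCell hA hG
      rw [e]
      exact S.measurableSet_codomain.inter
        (measurableSet_eq_fun ((measurable_vadd s).comp S.measurable_invMap)
          (S.measurable_invMap.comp (measurable_vadd g)))
    · refine Set.disjoint_left.2 fun y hy hy' => hs ?_
      rw [S.mem_targetCell] at hy hy'
      exact vadd_right_injective hn (hy.2.trans hy'.2.symm)
    · rw [S.mem_targetCell] at hy
      obtain ⟨d, hd, e⟩ := S.exists_invMap_vadd (y := y) (g := g) (K := K)
        fun i hi => not_not.1 (hK i hi)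
      rw [vadd_right_injective hn (hy.2.trans e)]
      exact hcast hd

end RearrangementScheme

/-! ### Choice of the scheme -/

theorem partialProduct_ne_zero (n : ℕ → ℕ+) (j : ℕ) : partialProduct n j ≠ 0 := NeZero.ne _

theorem factorization_partialProduct (n : ℕ → ℕ+) (j p : ℕ) :
    (partialProduct n j).factorization p =
      ∑ i ∈ Finset.range j, (n i : ℕ).factorization p := by
  rw [partialProduct, Nat.factorization_prod fun i _ => (n i).ne_zero]
  simp

namespace SupernaturalNumber

theorem IsProductOf.iSup_factorization {q : SupernaturalNumber} {n : ℕ → ℕ+}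
    (h : q.IsProductOf n) (p : Nat.Primes) :
    ⨆ j, ((partialProduct n j).factorization p : ℕ∞) = q p := by
  simp_rw [factorization_partialProduct]
  exact h p

/-- A bound on the levels would bound both the primes that occur and their exponents. -/
theorem IsProductOf.exists_lt_partialProduct {q : SupernaturalNumber} {n : ℕ → ℕ+}
    (h : q.IsProductOf n) (hq : q.HasInfinitelyManyPrimeFactors) (B : ℕ) :
    ∃ j, B < partialProduct n j := by
  by_contra! hB
  have hlog (p : Nat.Primes) (j : ℕ) : (partialProduct n j).factorization p < B :=
    (Nat.factorization_lt _ (partialProduct_ne_zero n j)).trans_le (hB j)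
  rcases hq with hq | ⟨p, hp⟩
  · refine hq (Set.Finite.of_finite_image (f := fun p : Nat.Primes => (p : ℕ))
      ((Set.finite_le_nat B).subset ?_) Subtype.val_injective.injOn)
    rintro _ ⟨p, hp, rfl⟩
    rw [Set.mem_ofPred_eq, ← h.iSup_factorization p] at hp
    have : ∃ j, (partialProduct n j).factorization p ≠ 0 := by
      by_contra! h0
      exact hp (by simp [h0])
    obtain ⟨j, hj⟩ := this
    exact (Nat.le_of_dvd (NeZero.pos _) (Nat.dvd_of_factorization_pos hj)).trans (hB j)
  · rw [← h.iSup_factorization p] at hp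
    have : ⨆ j, ((partialProduct n j).factorization p : ℕ∞) ≤ B :=
      iSup_le fun j => by exact_mod_cast (hlog p j).le
    rw [hp] at this
    exact absurd this (by simp)

theorem universal_hasInfinitelyManyPrimeFactors : universal.HasInfinitelyManyPrimeFactors :=
  Or.inr ⟨⟨2, Nat.prime_two⟩, rfl⟩

/-- Infinite exponents let each of the finitely many prime powers in `M` divide some level; the
largest of these levels serves for all. -/
theorem IsProductOf.exists_dvd_partialProduct {u : ℕ → ℕ+} (hu : universal.IsProductOf u)
    {M : ℕ} (hM : M ≠ 0) : ∃ j, M ∣ partialProduct u j := by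
  have h (p : ℕ) : ∃ j, M.factorization p ≤ (partialProduct u j).factorization p := by
    by_cases hp : p.Prime
    · have e := hu.iSup_factorization ⟨p, hp⟩
      obtain ⟨j, hj⟩ := lt_iSup_iff.1 (show (M.factorization p : ℕ∞) < _ by
        rw [e]; exact ENat.natCast_lt_top _)
      exact ⟨j, by exact_mod_cast hj.le⟩
    · exact ⟨0, by simp [Nat.factorization_eq_zero_of_not_prime _ hp]⟩
  choose j hj using h
  refine ⟨M.primeFactors.sup j, ?_⟩
  rw [← Nat.factorization_le_iff_dvd hM (partialProduct_ne_zero u _)]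
  intro p
  by_cases hp : p ∈ M.primeFactors
  · exact (hj p).trans ((Nat.factorization_le_iff_dvd (partialProduct_ne_zero u _)
      (partialProduct_ne_zero u _)).2 (partialProduct_dvd u (Finset.le_sup hp)) p)
  · rw [← Nat.support_factorization, Finsupp.notMem_support_iff] at hp
    omega

end SupernaturalNumber

theorem tendsto_mul_log_div (a b : ℝ) (hb : 0 < b) :
    Filter.Tendsto (fun x : ℝ => a * (1 + Real.log (b * x)) / x) Filter.atTop (nhds 0) := by
  have h1 : Filter.Tendsto (fun x : ℝ => Real.log x / x) Filter.atTop (nhds 0) := by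
    simpa using Real.isLittleO_log_id_atTop.tendsto_div_nhds_zero
  have h2 : Filter.Tendsto (fun x : ℝ => x⁻¹) Filter.atTop (nhds 0) := tendsto_inv_atTop_zero
  have h3 := (h2.const_mul (a * (1 + Real.log b))).add (h1.const_mul a)
  simp only [mul_zero, add_zero] at h3
  refine h3.congr' ?_
  filter_upwards [Filter.eventually_gt_atTop 0] with x hx
  rw [Real.log_mul hb.ne' hx.ne']
  field_simp
  ring

theorem tendsto_partialProduct {n : ℕ → ℕ+} (h : ∀ B : ℕ, ∃ j, B < partialProduct n j) :
    Filter.Tendsto (partialProduct n) Filter.atTop Filter.atTop := by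
  refine Filter.tendsto_atTop_atTop.2 fun B => ?_
  obtain ⟨j, hj⟩ := h B
  exact ⟨j, fun i hi => hj.le.trans (Nat.le_of_dvd (NeZero.pos _) (partialProduct_dvd n hi))⟩

/-- If the levels of `n` are unbounded and those of `u` are cofinal for divisibility, then there is
a scheme in which the lengths grow as fast as needed. -/
theorem exists_isFast {n u : ℕ → ℕ+} (hn : ∀ B : ℕ, ∃ j, B < partialProduct n j)
    (hu : ∀ M : ℕ, M ≠ 0 → ∃ j, M ∣ partialProduct u j) :
    ∃ S : RearrangementScheme n u, S.IsFast := by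
  -- Here `p` holds the index of the level `A k` and the number `G k`. The quotient is the `k`-th
  -- term of the series in `IsFast`; it tends to `0` in `j` because `p.2 * partialProduct u (k + 1)`
  -- does not depend on `j`.
  have step (k : ℕ) (p : ℕ × ℕ) : ∃ j, p.1 ≤ j ∧ k + 1 ≤ j ∧ (0 < p.2 →
      (p.2 : ℝ) * (1 + Real.log ((p.2 * partialProduct u (k + 1) : ℕ) * partialProduct n j)) /
        partialProduct n j ≤ (1 / 2) ^ k) := by
    by_cases hp : 0 < p.2
    · have hb : (0 : ℝ) < (p.2 * partialProduct u (k + 1) : ℕ) := by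
        exact_mod_cast Nat.mul_pos hp (NeZero.pos _)
      have ht := (tendsto_mul_log_div p.2 _ hb).comp
        (tendsto_natCast_atTop_atTop.comp (tendsto_partialProduct hn))
      obtain ⟨j, h1, h2, h3⟩ := ((Filter.eventually_ge_atTop p.1).and
        ((Filter.eventually_ge_atTop (k + 1)).and
          (ht.eventually (ge_mem_nhds (show (0 : ℝ) < (1 / 2) ^ k by positivity))))).exists
      exact ⟨j, h1, h2, fun _ => h3⟩
    · exact ⟨max p.1 (k + 1), le_max_left _ _, le_max_right _ _, fun h => absurd h hp⟩
  choose next h1 h2 h3 using step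
  let st : ℕ → ℕ × ℕ := Nat.rec (0, partialProduct u 0) fun k p =>
    (next k p, p.2 * partialProduct u (k + 1) * partialProduct n (next k p))
  have hst (k : ℕ) : st (k + 1) = (next k (st k), (st k).2 * partialProduct u (k + 1) *
    partialProduct n (next k (st k))) := rfl
  have hpos (k : ℕ) : 0 < (st k).2 := by
    induction k with
    | zero => exact NeZero.pos (partialProduct u 0)
    | succ k ih =>
      rw [hst]
      exact Nat.mul_pos (Nat.mul_pos ih (NeZero.pos _)) (NeZero.pos _)
  let S : RearrangementScheme n u :=
    { A := fun k => partialProduct n (st k).1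
      G := fun k => (st k).2
      -- The first factor makes `G k` divide `G (k + 1)`; the second makes the `G k` absorb every
      -- level of `u`.
      f := fun k => (st k).2 * partialProduct u (k + 1)
      cofinal_A :=
        { dvd_succ := fun k => partialProduct_dvd n (h1 k (st k))
          level_dvd := fun k => partialProduct_dvd n (by
            cases k with
            | zero => exact Nat.zero_le _
            | succ k => exact h2 k (st k))
          dvd_level := fun k => ⟨_, dvd_rfl⟩ }
      cofinal_G :=
        { dvd_succ := fun k => by
            rw [hst, mul_assoc]
            exact Nat.dvd_mul_right _ _
          level_dvd := fun k => by
            cases k with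
            | zero => exact dvd_rfl
            | succ k =>
              rw [hst]
              exact (Nat.dvd_mul_left _ _).mul_right _
          dvd_level := fun k => hu _ (hpos k).ne' }
      G_succ := fun k => rfl
      A_dvd_G := fun k => by
        cases k with
        | zero => exact one_dvd _
        | succ k =>
          rw [hst]
          exact Nat.dvd_mul_left _ _ }
  refine ⟨S, ?_⟩
  have hterm (i : ℕ) : (S.G i : ℝ≥0∞) / S.A (i + 1) *
      ENNReal.ofReal (1 + Real.log (S.G (i + 1))) ≤ ENNReal.ofReal ((1 / 2) ^ i) := by
    have hA : (0 : ℝ) < S.A (i + 1) := by exact_mod_cast S.cofinal_A.pos (i + 1)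
    rw [← ENNReal.ofReal_natCast (S.G i), ← ENNReal.ofReal_natCast (S.A (i + 1)),
      ← ENNReal.ofReal_div_of_pos hA, ← ENNReal.ofReal_mul (by positivity)]
    refine ENNReal.ofReal_le_ofReal (le_of_eq_of_le ?_ (h3 i (st i) (hpos i)))
    have e : (S.G (i + 1) : ℝ) = ((st i).2 * partialProduct u (i + 1) : ℕ) *
        partialProduct n (next i (st i)) := by
      rw [← Nat.cast_mul]
    rw [e, div_mul_eq_mul_div]
  exact ne_top_of_le_ne_top
    (summable_geometric_of_lt_one (by norm_num) (by norm_num : (1 / 2 : ℝ) < 1)).tsum_ofReal_ne_top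
    (ENNReal.tsum_le_tsum hterm)

theorem theoremC (q : SupernaturalNumber) (hq : q.HasInfinitelyManyPrimeFactors)
    (n : ℕ → ℕ+) (hn : q.IsProductOf n)
    (u : ℕ → ℕ+) (hu : SupernaturalNumber.universal.IsProductOf u) :
    ShannonOrbitEquivalent ℤ ℤ (Odometer.haar n) (Odometer.haar u) := by
  obtain ⟨S, hS⟩ := exists_isFast (hn.exists_lt_partialProduct hq)
    fun _ hM => hu.exists_dvd_partialProduct hM
  exact hS.shannonOrbitEquivalent (hn.exists_lt_partialProduct hq)
    (hu.exists_lt_partialProduct SupernaturalNumber.universal_hasInfinitelyManyPrimeFactors)
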